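/- \textbf{Setting.} For every sample size $n\ge 1$ let $d=d_n\ge 1$, let $\theta_0=\theta_{0,n}\in\mathbb{R}^d\setminus\{0\}$ have $s_0=s_{0,n}$ nonzero coordinates, and let $(Y,X)=(Y_n,X_n)$ be a random pair with values in $\{0,1\}\times\mathbb{R}^d$. Let $(Y_i,X_i)$, $1\le i\le n$, be i.i.d. copies of $(Y,X)$. The distribution of $(Y,X)$ (and the underlying probability space) may change with $n$. Write $|\cdot|_1,|\cdot|_2,|\cdot|_\infty$ for the $\ell_1$, $\ell_2$ and sup norms. \textbf{Assumptions.} There are constants $M_X$, $\rho_X>0$, $M_\sigma$, $M_0$ and a function $\sigma:\mathbb{R}\to[0,1]$, none of them depending on $n$, such that: \begin{itemize} \item for all $n\ge 1$: $|X|_\infty\le M_X$ almost surely, $E[X]=0$, $E[e^{X^\top v}]\le e^{M_X^2|v|_2^2/2}$ for all $v\in\mathbb{R}^d$, and the smallest eigenvalue of $E[XX^\top]$ is at least $\rho_X$; \item $\sigma$ is differentiable, $\inf_{|t|\le s}\sigma'(t)>0$ for every $s>0$, and $\sup_{t\in\mathbb{R}}\sigma'(t)\le M_\sigma$; \item for all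 $n\ge1$: $\mathbb{P}(Y=1\mid X)=\sigma(X^\top\theta_0)$ almost surely, and $|\theta_0|_2\le M_0$. \end{itemize} Let $\lambda_n=96M_\sigma M_X\sqrt{\log(4nd)/n}$ and let $\widehat\theta$ be any estimator with $$\widehat\theta\in\operatorname*{argmin}_{\theta\in\mathbb{R}^d}\ \frac1n\sum_{i=1}^n\bigl(Y_i-\sigma(X_i^\top\theta)\bigr)^2+\lambda_n|\theta|_1\quad\text{almost surely.}$$ \textbf{Conclusion.} If $\log(nd)\,|\theta_0|_1^2\,n^{-1}\to0$ as $n\to\infty$, then $$\left|\widehat\theta-\theta_0\right|_1=O_P\left(s_0\sqrt{\frac{\log(nd)}{n}}\right),$$ that is, for every $\varepsilon>0$ there is $K>0$ such that, for all sufficiently large $n$, $\mathbb{P}\bigl(|\widehat\theta-\theta_0|_1>K s_0\sqrt{\log(nd)/n}\bigr)\le\varepsilon$. -/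

import Mathlib

open MeasureTheory ProbabilityTheory Filter Topology

noncomputable section

/-- The `ℓ¹` norm of a vector (the `ℓ²` norm is the norm of `EuclideanSpace`). -/
def l1Norm {d : ℕ} (θ : EuclideanSpace ℝ (Fin d)) : ℝ := ∑ j, |θ j|

/-- The number of nonzero coordinates of a vector. -/
def numNonzero {d : ℕ} (θ : EuclideanSpace ℝ (Fin d)) : ℕ := {j | θ j ≠ 0}.ncard

/-- The second moment matrix `E[X Xᵀ]`. -/
def secondMoment {Ω : Type*} [MeasurableSpace Ω] {d : ℕ} (P : Measure Ω)
    (X : Ω → EuclideanSpace ℝ (Fin d)) : Matrix (Fin d) (Fin d) ℝ :=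
  Matrix.of fun j k => ∫ ω, X ω j * X ω k ∂P

/-- The conditions on the covariates: `|X|_∞ ≤ M` almost surely, `E[X] = 0`, `X` is `M²` sub-Gaussian
and the smallest eigenvalue of `E[X Xᵀ]` is at least `ρ`. -/
structure RegularCovariates {Ω : Type*} [MeasurableSpace Ω] {d : ℕ} (P : Measure Ω)
    (X : Ω → EuclideanSpace ℝ (Fin d)) (M ρ : ℝ) : Prop where
  bounded : ∀ᵐ ω ∂P, ∀ j, |X ω j| ≤ M
  mean_zero : ∫ ω, X ω ∂P = 0
  subgaussian : ∀ v : EuclideanSpace ℝ (Fin d),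
    ∫ ω, Real.exp (inner ℝ (X ω) v) ∂P ≤ Real.exp (M ^ 2 * ‖v‖ ^ 2 / 2)
  eigenvalue_ge : ∀ μ : ℝ,
    Module.End.HasEigenvalue (Matrix.toLin' (secondMoment P X)) μ → ρ ≤ μ

/-- The binary model: `Y ∈ {0, 1}` almost surely and `P(Y = 1 | X) = σ(Xᵀ θ₀)` almost surely. -/
structure BinaryModel {Ω : Type*} [MeasurableSpace Ω] {d : ℕ} (P : Measure Ω)
    (X : Ω → EuclideanSpace ℝ (Fin d)) (Y : Ω → ℝ) (σ : ℝ → ℝ)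
    (θ₀ : EuclideanSpace ℝ (Fin d)) : Prop where
  measurable_X : Measurable X
  measurable_Y : Measurable Y
  binary : ∀ᵐ ω ∂P, Y ω = 0 ∨ Y ω = 1
  condProb : P⟦Y ⁻¹' {1} | MeasurableSpace.comap X inferInstance⟧
    =ᵐ[P] fun ω => σ (inner ℝ (X ω) θ₀)

/-- `(x i, y i)`, `i : Fin n`, are independent copies of the pair `(X, Y)`. -/
structure IsIIDSample {Ω : Type*} [MeasurableSpace Ω] {d n : ℕ} (P : Measure Ω)
    (X : Ω → EuclideanSpace ℝ (Fin d)) (Y : Ω → ℝ)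
    (x : Fin n → Ω → EuclideanSpace ℝ (Fin d)) (y : Fin n → Ω → ℝ) : Prop where
  indep : iIndepFun (fun i ω => (x i ω, y i ω)) P
  identDistrib : ∀ i, IdentDistrib (fun ω => (x i ω, y i ω)) (fun ω => (X ω, Y ω)) P P

/-- The `ℓ¹`-penalized empirical least-squares criterion at `θ`, for the data `(x i, y i)`. -/
def penalizedRisk {d n : ℕ} (σ : ℝ → ℝ) (lam : ℝ)
    (x : Fin n → EuclideanSpace ℝ (Fin d)) (y : Fin n → ℝ)
    (θ : EuclideanSpace ℝ (Fin d)) : ℝ :=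
  (1 / (n : ℝ)) * ∑ i, (y i - σ (inner ℝ (x i) θ)) ^ 2 + lam * l1Norm θ

/-- `Z n = O_P(a n)`, where `Z n` lives on a probability space that may depend on `n`. (The measure of
a set that is not measurable is its outer measure.) -/
def IsBigOInProbability {Ω : ℕ → Type*} [∀ n, MeasurableSpace (Ω n)] (P : ∀ n, Measure (Ω n))
    (Z : ∀ n, Ω n → ℝ) (a : ℕ → ℝ) : Prop :=
  ∀ ε : ℝ, 0 < ε → ∃ K : ℝ, 0 < K ∧
    ∀ᶠ n in atTop, P n {ω | K * a n < |Z n ω|} ≤ ENNReal.ofReal ε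

end

/-! The criterion need not be convex in `θ`, so the estimator cannot be localized by a convexity
argument. Two estimates replace it, one stochastic and uniform over all scales, one about the
curvature of the population risk.

Stochastic side: the excess loss vanishes at `θ₀` and is `2 * Mσ`-Lipschitz in the linear predictor.
Symmetrization and contraction replace its empirical process over an `ℓ¹`-ball by a Rademacher
process of linear forms. By duality the latter is governed by the `2 * d` vertices of the ball,
which gives Gaussian tails at the price of a factor `2 * d` (`lintegral_pi_iSup_exp_le`). Peeling
over dyadic radii then shows that, with probability at least `1 - 1 / n`, excess risk minus
empirical excess risk is at most `lam / 2` times the `ℓ¹`-distance, for every `θ` at distance at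
least `1 / n` (`measure_pi_exists_lt_excessRisk_sub_le`).

Curvature side: the excess risk is the mean squared error of the link
(`BinaryModel.integral_excessLoss_map`). It dominates `c * min (‖θ - θ₀‖ ^ 2) 1` with `c` free of
the dimension, by the second-moment bound, the sub-Gaussian fourth moments and the slope of `σ` on a
compact interval (`exists_mul_min_le_integral_sq_sub`).

Comparing the estimator with `θ₀` in the criterion combines the two. Since `lam * l1Norm θ₀` tends
to `0`, the truncation at `1` is eventually inactive, and the usual Lasso computation on the support
of `θ₀` yields an error of order `lam` times the sparsity. -/

/-! ### Contraction for exponential moments with one random sign -/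

/-- Weak majorization for the convex increasing function `exp`: expand `(e^m - e^a)(e^m - e^b) ≥ 0`
and use `e^(a+b) ≤ e^m e^k`. -/
lemma Real.exp_add_exp_le_of_le {a b m k : ℝ} (ha : a ≤ m) (hb : b ≤ m) (h : a + b ≤ m + k) :
    Real.exp a + Real.exp b ≤ Real.exp m + Real.exp k := by
  have h1 : Real.exp (a + b) ≤ Real.exp m * Real.exp k := by
    rw [← Real.exp_add]; exact Real.exp_le_exp.2 h
  rw [Real.exp_add] at h1
  have h2 := Real.exp_le_exp.2 ha
  have h3 := Real.exp_le_exp.2 hb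
  have hm := Real.exp_pos m
  by_contra! hc
  nlinarith [mul_nonneg (sub_nonneg.2 h2) (sub_nonneg.2 h3), mul_lt_mul_of_pos_left hc hm]

/-- The two-point form of the contraction principle for exponential moments. -/
lemma Real.exp_add_exp_le_max_add_max {a b φ ψ u v : ℝ} (hφ : |φ| ≤ |u|) (hψ : |ψ| ≤ |v|)
    (h : |φ - ψ| ≤ |u - v|) :
    Real.exp (a + φ) + Real.exp (b - ψ) ≤ max (Real.exp (a + u)) (Real.exp (b + v)) +
      max (Real.exp (a - u)) (Real.exp (b - v)) := by
  have key : ∀ {p q m k : ℝ}, p ≤ max m k → q ≤ max m k → p + q ≤ m + k →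
      Real.exp p + Real.exp q ≤ Real.exp m + Real.exp k := by
    intro p q m k hp hq hpq
    rcases le_total m k with hmk | hmk
    · rw [max_eq_right hmk] at hp hq
      rw [add_comm (Real.exp m)]
      exact Real.exp_add_exp_le_of_le hp hq (by linarith)
    · rw [max_eq_left hmk] at hp hq
      exact Real.exp_add_exp_le_of_le hp hq hpq
  have e1 := le_max_left (Real.exp (a + u)) (Real.exp (b + v))
  have e2 := le_max_right (Real.exp (a + u)) (Real.exp (b + v))
  have e3 := le_max_left (Real.exp (a - u)) (Real.exp (b - v))
  have e4 := le_max_right (Real.exp (a - u)) (Real.exp (b - v))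
  have hφ' := abs_le.1 hφ
  have hψ' := abs_le.1 hψ
  have h' := abs_le.1 h
  -- If one index gives the larger exponent for both signs, it can serve alone, and `cosh φ ≤ cosh
  -- u` suffices. In the remaining case the two indices stay paired, with signs chosen according to
  -- the order of `u` and `v`.
  rcases lt_or_ge (a + φ) (b + ψ) with c1 | c1
  · have h1 := Real.exp_le_exp.2 c1.le
    have h2 : Real.exp (b + ψ) + Real.exp (b - ψ) ≤ Real.exp (b + v) + Real.exp (b - v) := by
      apply key
      · rcases abs_cases v with hv | hv
        · exact le_max_of_le_left (by linarith)
        · exact le_max_of_le_right (by linarith)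
      · rcases abs_cases v with hv | hv
        · exact le_max_of_le_left (by linarith)
        · exact le_max_of_le_right (by linarith)
      · linarith
    linarith
  rcases lt_or_ge (b - ψ) (a - φ) with c2 | c2
  · have h1 := Real.exp_le_exp.2 c2.le
    have h2 : Real.exp (a + φ) + Real.exp (a - φ) ≤ Real.exp (a + u) + Real.exp (a - u) := by
      apply key
      · rcases abs_cases u with hv | hv
        · exact le_max_of_le_left (by linarith)
        · exact le_max_of_le_right (by linarith)
      · rcases abs_cases u with hv | hv
        · exact le_max_of_le_left (by linarith)
        · exact le_max_of_le_right (by linarith)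
      · linarith
    linarith
  rcases le_total v u with c3 | c3
  · rw [abs_of_nonneg (sub_nonneg.2 c3)] at h'
    have : Real.exp (a + φ) + Real.exp (b - ψ) ≤ Real.exp (a + u) + Real.exp (b - v) := by
      apply key
      · rcases abs_cases u with hu | hu
        · exact le_max_of_le_left (by linarith)
        · exact le_max_of_le_right (by linarith)
      · rcases abs_cases v with hv | hv
        · exact le_max_of_le_left (by linarith)
        · exact le_max_of_le_right (by linarith)
      · linarith
    linarith
  · rw [abs_of_nonpos (sub_nonpos.2 c3)] at h'
    have : Real.exp (a + φ) + Real.exp (b - ψ) ≤ Real.exp (a - u) + Real.exp (b + v) := by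
      apply key
      · rcases abs_cases u with hu | hu
        · exact le_max_of_le_right (by linarith)
        · exact le_max_of_le_left (by linarith)
      · rcases abs_cases v with hv | hv
        · exact le_max_of_le_right (by linarith)
        · exact le_max_of_le_left (by linarith)
      · linarith
    linarith

/-- The contraction principle for exponential moments and a single Rademacher variable. -/
lemma iSup_ofReal_exp_add_le {ι : Type*} (a φ u : ι → ℝ) (h₀ : ∀ k, |φ k| ≤ |u k|)
    (h₁ : ∀ k l, |φ k - φ l| ≤ |u k - u l|) :
    (⨆ k, ENNReal.ofReal (Real.exp (a k + φ k))) + (⨆ k, ENNReal.ofReal (Real.exp (a k - φ k))) ≤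
    (⨆ k, ENNReal.ofReal (Real.exp (a k + u k))) +
      (⨆ k, ENNReal.ofReal (Real.exp (a k - u k))) := by
  rcases isEmpty_or_nonempty ι with hι | hι
  · simp
  refine ENNReal.iSup_add_iSup_le fun k l => ?_
  rw [← ENNReal.ofReal_add (Real.exp_pos _).le (Real.exp_pos _).le]
  refine (ENNReal.ofReal_le_ofReal
    (Real.exp_add_exp_le_max_add_max (h₀ k) (h₀ l) (h₁ k l))).trans ?_
  rw [ENNReal.ofReal_add (by positivity) (by positivity)]
  have hmono : Monotone ENNReal.ofReal := ENNReal.ofReal_mono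
  rw [hmono.map_max, hmono.map_max]
  gcongr
  · exact max_le (le_iSup (fun k => ENNReal.ofReal (Real.exp (a k + u k))) k)
      (le_iSup (fun k => ENNReal.ofReal (Real.exp (a k + u k))) l)
  · exact max_le (le_iSup (fun k => ENNReal.ofReal (Real.exp (a k - u k))) k)
      (le_iSup (fun k => ENNReal.ofReal (Real.exp (a k - u k))) l)

/-! ### Symmetrization and tails of the supremum over an `ℓ¹`-ball -/

section ExponentialMoments

variable {𝒵 : Type*} [MeasurableSpace 𝒵]

lemma ofReal_exp_integral_le (μ : Measure 𝒵) [IsProbabilityMeasure μ] {g : 𝒵 → ℝ}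
    (hg : Measurable g) {C : ℝ} (hC : ∀ᵐ z ∂μ, |g z| ≤ C) :
    ENNReal.ofReal (Real.exp (∫ z, g z ∂μ)) ≤ ∫⁻ z, ENNReal.ofReal (Real.exp (g z)) ∂μ := by
  have hi : Integrable g μ := Integrable.of_bound hg.aestronglyMeasurable C hC
  have hi' : Integrable (fun z => Real.exp (g z)) μ := by
    refine Integrable.of_bound (by fun_prop) (Real.exp C) ?_
    filter_upwards [hC] with z hz
    rw [Real.norm_eq_abs, abs_of_pos (Real.exp_pos _)]
    exact Real.exp_le_exp.2 (le_of_abs_le hz)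
  rw [← ofReal_integral_eq_lintegral_ofReal hi' (ae_of_all _ fun z => (Real.exp_pos _).le)]
  exact ENNReal.ofReal_le_ofReal
    (convexOn_exp.map_integral_le Real.continuous_exp.continuousOn isClosed_univ (by simp) hi hi')

/-- Symmetrization and contraction of a single summand. -/
lemma lintegral_iSup_exp_sub_integral_le {ι : Type*} [Countable ι] (μ : Measure 𝒵)
    [IsProbabilityMeasure μ] (a : ι → ℝ) {f u : ι → 𝒵 → ℝ} (hf : ∀ k, Measurable (f k))
    (hfb : ∀ k, ∃ C, ∀ᵐ z ∂μ, |f k z| ≤ C)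
    (h₀ : ∀ᵐ z ∂μ, ∀ k, |f k z| ≤ |u k z|)
    (h₁ : ∀ᵐ z ∂μ, ∀ k l, |f k z - f l z| ≤ |u k z - u l z|) :
    ∫⁻ z, ⨆ k, ENNReal.ofReal (Real.exp (a k + (f k z - ∫ z', f k z' ∂μ))) ∂μ ≤
    ∫⁻ z, 2⁻¹ * ((⨆ k, ENNReal.ofReal (Real.exp (a k + 2 * u k z))) +
      (⨆ k, ENNReal.ofReal (Real.exp (a k - 2 * u k z)))) ∂μ := by
  have hm1 : Measurable fun z => ⨆ k, ENNReal.ofReal (Real.exp (a k + 2 * f k z)) :=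
    Measurable.iSup fun k => by have := hf k; fun_prop
  have hm2 : Measurable fun z => ⨆ k, ENNReal.ofReal (Real.exp (a k - 2 * f k z)) :=
    Measurable.iSup fun k => by have := hf k; fun_prop
  calc ∫⁻ z, ⨆ k, ENNReal.ofReal (Real.exp (a k + (f k z - ∫ z', f k z' ∂μ))) ∂μ
      ≤ ∫⁻ z, 2⁻¹ * ((⨆ k, ENNReal.ofReal (Real.exp (a k + 2 * f k z))) +
          ∫⁻ z', (⨆ k, ENNReal.ofReal (Real.exp (a k - 2 * f k z'))) ∂μ) ∂μ := by
        refine lintegral_mono fun z => iSup_le fun k => ?_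
        have hfk := hf k
        obtain ⟨C, hC⟩ := hfb k
        have hint : Integrable (f k) μ := Integrable.of_bound hfk.aestronglyMeasurable C hC
        have e : a k + (f k z - ∫ z', f k z' ∂μ) = ∫ z', (a k + f k z - f k z') ∂μ := by
          rw [integral_sub (integrable_const _) hint]; simp; ring
        rw [e]
        refine (ofReal_exp_integral_le μ (by fun_prop) (C := |a k + f k z| + C) ?_).trans ?_
        · filter_upwards [hC] with z' hz'
          exact (abs_sub _ _).trans (by linarith)
        -- The mean of `f k` has become an independent copy `z'` by Jensen. The arithmetic-geometric
        -- mean inequality decouples `z` from `z'`, so the two suprema can be taken separately; this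
        -- costs the factor `2` in the exponents and produces the two signs of a Rademacher
        -- variable.
        have step : ∀ z', ENNReal.ofReal (Real.exp (a k + f k z - f k z')) ≤
            2⁻¹ * (ENNReal.ofReal (Real.exp (a k + 2 * f k z)) +
              ENNReal.ofReal (Real.exp (a k - 2 * f k z'))) := by
          intro z'
          rw [← ENNReal.ofReal_add (Real.exp_pos _).le (Real.exp_pos _).le,
            show (2⁻¹ : ENNReal) = ENNReal.ofReal 2⁻¹ by
              rw [ENNReal.ofReal_inv_of_pos two_pos]; simp,
            ← ENNReal.ofReal_mul (by norm_num)]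
          refine ENNReal.ofReal_le_ofReal ?_
          have h2 : a k + f k z - f k z' = (a k + 2 * f k z) / 2 + (a k - 2 * f k z') / 2 := by ring
          have e1 : Real.exp (a k + 2 * f k z) = Real.exp ((a k + 2 * f k z) / 2) ^ 2 := by
            rw [← Real.exp_nat_mul]; congr 1; push_cast; ring
          have e2 : Real.exp (a k - 2 * f k z') = Real.exp ((a k - 2 * f k z') / 2) ^ 2 := by
            rw [← Real.exp_nat_mul]; congr 1; push_cast; ring
          rw [h2, Real.exp_add, e1, e2]
          nlinarith [sq_nonneg (Real.exp ((a k + 2 * f k z) / 2) -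
            Real.exp ((a k - 2 * f k z') / 2))]
        refine (lintegral_mono step).trans ?_
        rw [lintegral_const_mul _ (by fun_prop), lintegral_add_left measurable_const]
        simp only [lintegral_const, measure_univ, mul_one]
        exact mul_le_mul_right (add_le_add
          (le_iSup (fun k => ENNReal.ofReal (Real.exp (a k + 2 * f k z))) k)
          (lintegral_mono fun z' =>
            le_iSup (fun k => ENNReal.ofReal (Real.exp (a k - 2 * f k z'))) k)) _
    _ = ∫⁻ z, 2⁻¹ * ((⨆ k, ENNReal.ofReal (Real.exp (a k + 2 * f k z))) +
          (⨆ k, ENNReal.ofReal (Real.exp (a k - 2 * f k z)))) ∂μ := by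
        rw [lintegral_const_mul _ (by fun_prop), lintegral_const_mul _ (by fun_prop),
          lintegral_add_left hm1, lintegral_add_left hm1]
        simp
    _ ≤ _ := by
        refine lintegral_mono_ae ?_
        filter_upwards [h₀, h₁] with z hz0 hz1
        gcongr 2⁻¹ * ?_
        refine iSup_ofReal_exp_add_le a (fun k => 2 * f k z) (fun k => 2 * u k z) (fun k => ?_)
          fun k l => ?_
        · rw [abs_mul, abs_mul]
          exact mul_le_mul_of_nonneg_left (hz0 k) (abs_nonneg _)
        · rw [← mul_sub, ← mul_sub, abs_mul, abs_mul]
          exact mul_le_mul_of_nonneg_left (hz1 k l) (abs_nonneg _)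

lemma inner_eq_sum_mul {d : ℕ} (w v : EuclideanSpace ℝ (Fin d)) :
    inner ℝ w v = ∑ j, w j * v j := by
  simp [PiLp.inner_apply, mul_comm]

lemma abs_inner_le_mul_l1Norm {d : ℕ} {w v : EuclideanSpace ℝ (Fin d)} {M : ℝ}
    (hw : ∀ j, |w j| ≤ M) : |inner ℝ w v| ≤ M * l1Norm v := by
  rw [inner_eq_sum_mul, l1Norm, Finset.mul_sum]
  refine (Finset.abs_sum_le_sum_abs _ _).trans (Finset.sum_le_sum fun j _ => ?_)
  rw [abs_mul]
  exact mul_le_mul_of_nonneg_right (hw j) (abs_nonneg _)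

lemma l1Norm_nonneg {d : ℕ} (v : EuclideanSpace ℝ (Fin d)) : 0 ≤ l1Norm v :=
  Finset.sum_nonneg fun _ _ => abs_nonneg _

/-- The sum over the vertices of the `ℓ¹`-ball of radius `R` of the exponential of a linear form. -/
noncomputable def crossExp {d : ℕ} (R : ℝ) (w : EuclideanSpace ℝ (Fin d)) : ℝ :=
  ∑ j, (Real.exp (R * w j) + Real.exp (-(R * w j)))

/-- A linear form on the `ℓ¹`-ball is largest at a vertex, so a supremum over the ball becomes a sum
of `2 * d` exponentials. -/
lemma exp_inner_le_crossExp {d : ℕ} [NeZero d] {R : ℝ} (hR : 0 ≤ R)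
    (w v : EuclideanSpace ℝ (Fin d)) (hv : l1Norm v ≤ R) :
    Real.exp (inner ℝ w v) ≤ crossExp R w := by
  obtain ⟨j, hj⟩ := Finite.exists_max fun j => |w j|
  have h1 : inner ℝ w v ≤ |R * w j| := by
    refine (le_abs_self _).trans ((abs_inner_le_mul_l1Norm hj).trans ?_)
    rw [abs_mul, abs_of_nonneg hR, mul_comm]
    gcongr
  have h2 : Real.exp |R * w j| ≤ Real.exp (R * w j) + Real.exp (-(R * w j)) := by
    rcases abs_cases (R * w j) with h | h <;> rw [h.1] <;>
      linarith [Real.exp_pos (R * w j), Real.exp_pos (-(R * w j))]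
  refine (Real.exp_le_exp.2 h1).trans (h2.trans ?_)
  exact Finset.single_le_sum (f := fun j => Real.exp (R * w j) + Real.exp (-(R * w j)))
    (fun _ _ => by positivity) (Finset.mem_univ j)

lemma exp_add_add_exp_sub_le {b t c : ℝ} (ht : |t| ≤ c) :
    Real.exp (b + t) + Real.exp (b - t) ≤ 2 * (Real.exp (c ^ 2 / 2) * Real.exp b) := by
  have h1 := Real.cosh_le_exp_half_sq t
  have h2 : Real.exp (t ^ 2 / 2) ≤ Real.exp (c ^ 2 / 2) := by
    apply Real.exp_le_exp.2
    have := sq_le_sq' (neg_le_of_abs_le ht) (le_of_abs_le ht)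
    linarith
  rw [sub_eq_add_neg, Real.exp_add, Real.exp_add]
  rw [Real.cosh_eq] at h1
  nlinarith [Real.exp_pos b]

/-- Averaging over a random sign in front of `h` costs at each vertex only the sub-Gaussian factor
coming from `cosh t ≤ exp (t ^ 2 / 2)`. This is the gain made per observation. -/
lemma crossExp_add_add_crossExp_sub_le {d : ℕ} {R K : ℝ} (hR : 0 ≤ R)
    (w h : EuclideanSpace ℝ (Fin d)) (hh : ∀ j, |h j| ≤ K) :
    2⁻¹ * (crossExp R (w + h) + crossExp R (w - h)) ≤
      Real.exp ((R * K) ^ 2 / 2) * crossExp R w := by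
  simp only [crossExp]
  rw [← Finset.sum_add_distrib, Finset.mul_sum, Finset.mul_sum]
  refine Finset.sum_le_sum fun j _ => ?_
  have ht : |R * h j| ≤ R * K := by
    rw [abs_mul, abs_of_nonneg hR]; exact mul_le_mul_of_nonneg_left (hh j) hR
  have h1 := exp_add_add_exp_sub_le (b := R * w j) ht
  have h2 := exp_add_add_exp_sub_le (b := -(R * w j)) ht
  simp only [PiLp.add_apply, PiLp.sub_apply]
  rw [show R * (w j + h j) = R * w j + R * h j by ring,
    show R * (w j - h j) = R * w j - R * h j by ring,
    show -(R * w j + R * h j) = -(R * w j) - R * h j by ring,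
    show -(R * w j - R * h j) = -(R * w j) + R * h j by ring]
  linarith

lemma inv_two_mul_ofReal_exp_mul_crossExp_add_le {d : ℕ} {R K : ℝ} (hR : 0 ≤ R)
    (w h : EuclideanSpace ℝ (Fin d)) (hh : ∀ j, |h j| ≤ K) (m : ℕ) :
    2⁻¹ * (ENNReal.ofReal (Real.exp (m * ((R * K) ^ 2 / 2)) * crossExp R (w + h)) +
      ENNReal.ofReal (Real.exp (m * ((R * K) ^ 2 / 2)) * crossExp R (w - h))) ≤
      ENNReal.ofReal (Real.exp ((m + 1 : ℕ) * ((R * K) ^ 2 / 2)) * crossExp R w) := by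
  have hc0 : ∀ w : EuclideanSpace ℝ (Fin d), 0 ≤ crossExp R w := fun w =>
    Finset.sum_nonneg fun _ _ => by positivity
  rw [← ENNReal.ofReal_add (mul_nonneg (Real.exp_pos _).le (hc0 _))
    (mul_nonneg (Real.exp_pos _).le (hc0 _)),
    show (2⁻¹ : ENNReal) = ENNReal.ofReal 2⁻¹ by
      rw [ENNReal.ofReal_inv_of_pos two_pos]; simp,
    ← ENNReal.ofReal_mul (by norm_num)]
  refine ENNReal.ofReal_le_ofReal ?_
  have hcr := crossExp_add_add_crossExp_sub_le hR w h hh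
  set c := (R * K) ^ 2 / 2
  rw [show ((m + 1 : ℕ) : ℝ) * c = m * c + c by push_cast; ring, Real.exp_add]
  have := mul_le_mul_of_nonneg_left hcr (Real.exp_pos (m * c)).le
  linarith

/-- An exponential moment bound for the supremum of a centred empirical process that is Lipschitz
in a linear process indexed by a subset of an `ℓ¹`-ball. -/
lemma lintegral_pi_iSup_exp_le {ι : Type*} [Countable ι] {d : ℕ} [NeZero d] (μ : Measure 𝒵)
    [IsProbabilityMeasure μ] {X : 𝒵 → EuclideanSpace ℝ (Fin d)} (hX : Measurable X)
    {M L R : ℝ} (hL : 0 ≤ L) (hR : 0 ≤ R) (hM : ∀ᵐ z ∂μ, ∀ j, |X z j| ≤ M)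
    {v : ι → EuclideanSpace ℝ (Fin d)} (hv : ∀ k, l1Norm (v k) ≤ R)
    {f : ι → 𝒵 → ℝ} (hf : ∀ k, Measurable (f k))
    (h₀ : ∀ᵐ z ∂μ, ∀ k, |f k z| ≤ L * |inner ℝ (X z) (v k)|)
    (h₁ : ∀ᵐ z ∂μ, ∀ k l, |f k z - f l z| ≤ L * |inner ℝ (X z) (v k) - inner ℝ (X z) (v l)|)
    (m : ℕ) (w : EuclideanSpace ℝ (Fin d)) :
    ∫⁻ z, ⨆ k, ENNReal.ofReal (Real.exp (inner ℝ w (v k) +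
      ∑ i, (f k (z i) - ∫ z', f k z' ∂μ))) ∂(Measure.pi fun _ : Fin m => μ) ≤
    ENNReal.ofReal (Real.exp (m * ((R * (2 * L * M)) ^ 2 / 2)) * crossExp R w) := by
  -- The linear offset `w` makes the induction close: once one observation is symmetrized and
  -- contracted, its contribution is `± 2 * L` times a linear form in `v k`, which is absorbed into
  -- `w`.
  induction m generalizing w with
  | zero =>
    simp only [Finset.univ_eq_empty, Finset.sum_empty, add_zero, lintegral_const, measure_univ,
      mul_one, CharP.cast_eq_zero, zero_mul, Real.exp_zero, one_mul]
    exact iSup_le fun k => ENNReal.ofReal_le_ofReal (exp_inner_le_crossExp hR w (v k) (hv k))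
  | succ m ih =>
    have hfb : ∀ k, ∃ C, ∀ᵐ z ∂μ, |f k z| ≤ C := fun k => ⟨L * (M * R), by
      filter_upwards [h₀, hM] with z hz hzM
      refine (hz k).trans (mul_le_mul_of_nonneg_left ?_ hL)
      have hM0 : 0 ≤ M := (abs_nonneg _).trans (hzM 0)
      exact (abs_inner_le_mul_l1Norm hzM).trans (mul_le_mul_of_nonneg_left (hv k) hM0)⟩
    have hmp := measurePreserving_piFinSuccAbove (fun _ : Fin (m + 1) => μ) 0
    rw [← (hmp.symm).lintegral_comp_emb (MeasurableEquiv.measurableEmbedding _)]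
    have hpt : ∀ (p : 𝒵 × (Fin m → 𝒵)) k,
        inner ℝ w (v k) + ∑ i : Fin (m + 1), (f k ((MeasurableEquiv.piFinSuccAbove
          (fun _ : Fin (m + 1) => 𝒵) 0).symm p i) - ∫ z', f k z' ∂μ) =
        (inner ℝ w (v k) + ∑ i, (f k (p.2 i) - ∫ z', f k z' ∂μ)) +
          (f k p.1 - ∫ z', f k z' ∂μ) := by
      intro p k
      rw [Fin.sum_univ_succ]
      simp [MeasurableEquiv.piFinSuccAbove, Fin.insertNthEquiv]
      ring
    simp only [hpt]
    have hmeas : ∀ (k : ι) (w' : EuclideanSpace ℝ (Fin d)), Measurable fun y : Fin m → 𝒵 =>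
        inner ℝ w' (v k) + ∑ i, (f k (y i) - ∫ z', f k z' ∂μ) := by
      intro k w'
      have := hf k
      fun_prop
    rw [lintegral_prod_symm]
    swap
    · refine (Measurable.iSup fun k => ?_).aemeasurable
      have h1 := hf k
      have h2 := hmeas k w
      exact ENNReal.measurable_ofReal.comp (Real.measurable_exp.comp
        ((h2.comp measurable_snd).add ((h1.comp measurable_fst).sub measurable_const)))
    set g : 𝒵 → (Fin m → 𝒵) → ℝ → ENNReal := fun x y ε => ⨆ k, ENNReal.ofReal (Real.exp
      (inner ℝ (w + (ε * (2 * L)) • X x) (v k) + ∑ i, (f k (y i) - ∫ z', f k z' ∂μ))) with hg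
    have hgm : ∀ ε, Measurable fun p : 𝒵 × (Fin m → 𝒵) => g p.1 p.2 ε := by
      intro ε
      refine Measurable.iSup fun k => ?_
      have h1 := hf k
      have h2 := hmeas k 0
      simp only [inner_zero_left, zero_add] at h2
      refine ENNReal.measurable_ofReal.comp (Real.measurable_exp.comp
        (Measurable.add ?_ (h2.comp measurable_snd)))
      fun_prop
    have hstep : ∀ y : Fin m → 𝒵, ∫⁻ x, ⨆ k, ENNReal.ofReal (Real.exp
        ((inner ℝ w (v k) + ∑ i, (f k (y i) - ∫ z', f k z' ∂μ)) +
          (f k x - ∫ z', f k z' ∂μ))) ∂μ ≤ ∫⁻ x, 2⁻¹ * (g x y 1 + g x y (-1)) ∂μ := by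
      intro y
      refine (lintegral_iSup_exp_sub_integral_le μ _ (u := fun k z => L * inner ℝ (X z) (v k))
        hf hfb ?_ ?_).trans (le_of_eq ?_)
      · filter_upwards [h₀] with z hz k
        rw [abs_mul, abs_of_nonneg hL]; exact hz k
      · filter_upwards [h₁] with z hz k l
        rw [← mul_sub, abs_mul, abs_of_nonneg hL]; exact hz k l
      · refine lintegral_congr fun x => ?_
        simp only [hg, inner_add_left, real_inner_smul_left]
        congr 3 <;> ext k <;> congr 2 <;> ring
    refine (lintegral_mono hstep).trans ?_
    set c := (R * (2 * L * M)) ^ 2 / 2 with hc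
    have hint : ∀ x ε, ∫⁻ y, g x y ε ∂(Measure.pi fun _ : Fin m => μ) ≤ ENNReal.ofReal
        (Real.exp (m * c) * crossExp R (w + (ε * (2 * L)) • X x)) := fun x ε =>
      ih (w + (ε * (2 * L)) • X x)
    clear_value g
    clear hstep ih hpt hmeas
    have hgm' : Measurable fun p : 𝒵 × (Fin m → 𝒵) => 2⁻¹ * (g p.1 p.2 1 + g p.1 p.2 (-1)) :=
      ((hgm 1).add (hgm (-1))).const_mul _
    rw [lintegral_lintegral_swap (f := fun y x => 2⁻¹ * (g x y 1 + g x y (-1)))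
      (hgm'.comp measurable_swap).aemeasurable]
    have hbound : ∀ᵐ x ∂μ, ∫⁻ y, 2⁻¹ * (g x y 1 + g x y (-1)) ∂(Measure.pi fun _ : Fin m => μ) ≤
        ENNReal.ofReal (Real.exp ((m + 1 : ℕ) * c) * crossExp R w) := by
      filter_upwards [hM] with x hx
      have hm1 : ∀ ε, Measurable fun y => g x y ε := fun ε =>
        (hgm ε).comp measurable_prodMk_left
      have hm2 : Measurable fun y => g x y 1 + g x y (-1) := (hm1 1).add (hm1 (-1))
      rw [lintegral_const_mul _ hm2, lintegral_add_left (hm1 1)]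
      have i1 := hint x 1
      have i2 := hint x (-1)
      have e1 : w + ((1 : ℝ) * (2 * L)) • X x = w + (2 * L) • X x := by rw [one_mul]
      have e2 : w + ((-1 : ℝ) * (2 * L)) • X x = w - (2 * L) • X x := by
        rw [neg_one_mul, neg_smul, sub_eq_add_neg]
      rw [e1] at i1
      rw [e2] at i2
      refine (mul_le_mul_right (add_le_add i1 i2) _).trans
        (inv_two_mul_ofReal_exp_mul_crossExp_add_le hR w ((2 * L) • X x) (fun j => ?_) m)
      rw [PiLp.smul_apply, smul_eq_mul, abs_mul, abs_of_nonneg (by positivity)]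
      exact mul_le_mul_of_nonneg_left (hx j) (by positivity)
    refine (lintegral_mono_ae hbound).trans ?_
    simp

/-- Chernoff's bound applied to the exponential moment at `w = 0`, where `crossExp` counts the `2 *
d` vertices. -/
lemma measure_pi_exists_le_sum {ι : Type*} [Countable ι] {d : ℕ} [NeZero d] (μ : Measure 𝒵)
    [IsProbabilityMeasure μ] {X : 𝒵 → EuclideanSpace ℝ (Fin d)} (hX : Measurable X)
    {M L R : ℝ} (hL : 0 < L) (hR : 0 < R) (hM0 : 0 < M) (hM : ∀ᵐ z ∂μ, ∀ j, |X z j| ≤ M)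
    {v : ι → EuclideanSpace ℝ (Fin d)} (hv : ∀ k, l1Norm (v k) ≤ R)
    {f : ι → 𝒵 → ℝ} (hf : ∀ k, Measurable (f k))
    (h₀ : ∀ᵐ z ∂μ, ∀ k, |f k z| ≤ L * |inner ℝ (X z) (v k)|)
    (h₁ : ∀ᵐ z ∂μ, ∀ k l, |f k z - f l z| ≤ L * |inner ℝ (X z) (v k) - inner ℝ (X z) (v l)|)
    {n : ℕ} (hn : 1 ≤ n) {t : ℝ} (ht : 0 < t) :
    (Measure.pi fun _ : Fin n => μ) {z | ∃ k, t ≤ ∑ i, (f k (z i) - ∫ z', f k z' ∂μ)} ≤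
      ENNReal.ofReal (2 * d * Real.exp (-(t ^ 2 / (2 * n * (R * (2 * L * M)) ^ 2)))) := by
  set c := R * (2 * L * M) with hc
  have hc0 : 0 < c := by positivity
  have hn0 : (0 : ℝ) < n := by exact_mod_cast hn
  -- The minimizer of `n * s ^ 2 * c ^ 2 / 2 - s * t`. Scaling `f` by `s` scales the Lipschitz
  -- constant and leaves `R` alone.
  set s := t / (n * c ^ 2) with hs
  have hs0 : 0 < s := by positivity
  have key := lintegral_pi_iSup_exp_le μ hX (L := s * L) (by positivity) hR.le hM hv
    (f := fun k z => s * f k z) (fun k => (hf k).const_mul s)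
    (by filter_upwards [h₀] with z hz k
        rw [abs_mul, abs_of_pos hs0, mul_assoc]
        exact mul_le_mul_of_nonneg_left (hz k) hs0.le)
    (by filter_upwards [h₁] with z hz k l
        rw [← mul_sub, abs_mul, abs_of_pos hs0, mul_assoc]
        exact mul_le_mul_of_nonneg_left (hz k l) hs0.le) n 0
  have hsub : {z : Fin n → 𝒵 | ∃ k, t ≤ ∑ i, (f k (z i) - ∫ z', f k z' ∂μ)} ⊆
      {z | ENNReal.ofReal (Real.exp (s * t)) ≤ ⨆ k, ENNReal.ofReal (Real.exp
        (inner ℝ (0 : EuclideanSpace ℝ (Fin d)) (v k) +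
        ∑ i, (s * f k (z i) - ∫ z', s * f k z' ∂μ)))} := by
    rintro z ⟨k, hk⟩
    refine le_trans ?_ (le_iSup (fun k => ENNReal.ofReal (Real.exp
      (inner ℝ (0 : EuclideanSpace ℝ (Fin d)) (v k) +
        ∑ i, (s * f k (z i) - ∫ z', s * f k z' ∂μ)))) k)
    refine ENNReal.ofReal_le_ofReal (Real.exp_le_exp.2 ?_)
    simp only [integral_const_mul, ← mul_sub, ← Finset.mul_sum, inner_zero_left, zero_add]
    exact mul_le_mul_of_nonneg_left hk hs0.le
  refine (measure_mono hsub).trans ?_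
  refine (meas_ge_le_lintegral_div ?_ (by simp [Real.exp_pos]) ENNReal.ofReal_ne_top).trans ?_
  · refine (Measurable.iSup fun k => ?_).aemeasurable
    have := hf k
    fun_prop
  refine (ENNReal.div_le_div_right key _).trans ?_
  rw [← ENNReal.ofReal_div_of_pos (Real.exp_pos _)]
  refine ENNReal.ofReal_le_ofReal (le_of_eq ?_)
  have h0 : crossExp R (0 : EuclideanSpace ℝ (Fin d)) = 2 * d := by
    simp [crossExp]; ring
  rw [h0, mul_comm (Real.exp _), mul_div_assoc, ← Real.exp_sub]
  congr 2
  rw [show R * (2 * (s * L) * M) = s * c by rw [hc]; ring, hs]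
  field_simp
  ring

end ExponentialMoments

/-! ### Excess loss: Lipschitz bounds and peeling -/

/-- The difference of the squared losses at `θ` and at `θ₀` for the observation `z = (x, y)`. -/
noncomputable def excessLoss {d : ℕ} (σ : ℝ → ℝ) (θ₀ θ : EuclideanSpace ℝ (Fin d))
    (z : EuclideanSpace ℝ (Fin d) × ℝ) : ℝ :=
  (z.2 - σ (inner ℝ z.1 θ)) ^ 2 - (z.2 - σ (inner ℝ z.1 θ₀)) ^ 2

section ExcessLoss

variable {d : ℕ} {σ : ℝ → ℝ} {θ₀ : EuclideanSpace ℝ (Fin d)}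

lemma measurable_excessLoss (hσ : Continuous σ) (θ : EuclideanSpace ℝ (Fin d)) :
    Measurable (excessLoss σ θ₀ θ) := by
  unfold excessLoss
  have := hσ.measurable
  fun_prop

lemma continuous_excessLoss_apply (hσ : Continuous σ) (z : EuclideanSpace ℝ (Fin d) × ℝ) :
    Continuous fun θ => excessLoss σ θ₀ θ z := by
  unfold excessLoss
  fun_prop

lemma excessLoss_self (z : EuclideanSpace ℝ (Fin d) × ℝ) : excessLoss σ θ₀ θ₀ z = 0 := by
  simp [excessLoss]

lemma abs_excessLoss_le (hσ : ∀ t, σ t ∈ Set.Icc (0 : ℝ) 1) (θ : EuclideanSpace ℝ (Fin d))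
    {z : EuclideanSpace ℝ (Fin d) × ℝ} (hz : z.2 ∈ Set.Icc (0 : ℝ) 1) :
    |excessLoss σ θ₀ θ z| ≤ 1 := by
  have h1 := hσ (inner ℝ z.1 θ)
  have h2 := hσ (inner ℝ z.1 θ₀)
  unfold excessLoss
  obtain ⟨a, b⟩ := h1
  obtain ⟨a', b'⟩ := h2
  obtain ⟨a'', b''⟩ := hz
  rw [abs_le]
  constructor <;> nlinarith

lemma abs_excessLoss_sub_le {Mσ : ℝ} (hσ : ∀ t, σ t ∈ Set.Icc (0 : ℝ) 1)
    (hL : ∀ a b, |σ a - σ b| ≤ Mσ * |a - b|) (θ θ' : EuclideanSpace ℝ (Fin d))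
    {z : EuclideanSpace ℝ (Fin d) × ℝ} (hz : z.2 ∈ Set.Icc (0 : ℝ) 1) :
    |excessLoss σ θ₀ θ z - excessLoss σ θ₀ θ' z| ≤
      2 * Mσ * |inner ℝ z.1 θ - inner ℝ z.1 θ'| := by
  have h1 := hσ (inner ℝ z.1 θ)
  have h2 := hσ (inner ℝ z.1 θ')
  have h3 := hL (inner ℝ z.1 θ) (inner ℝ z.1 θ')
  unfold excessLoss
  rw [show (z.2 - σ (inner ℝ z.1 θ)) ^ 2 - (z.2 - σ (inner ℝ z.1 θ₀)) ^ 2 -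
      ((z.2 - σ (inner ℝ z.1 θ')) ^ 2 - (z.2 - σ (inner ℝ z.1 θ₀)) ^ 2) =
      (σ (inner ℝ z.1 θ) - σ (inner ℝ z.1 θ')) *
        (σ (inner ℝ z.1 θ) + σ (inner ℝ z.1 θ') - 2 * z.2) by ring, abs_mul]
  have h4 : |σ (inner ℝ z.1 θ) + σ (inner ℝ z.1 θ') - 2 * z.2| ≤ 2 := by
    rw [abs_le]
    constructor <;> linarith [h1.1, h1.2, h2.1, h2.2, hz.1, hz.2]
  calc _ ≤ |σ (inner ℝ z.1 θ) - σ (inner ℝ z.1 θ')| * 2 := by gcongr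
    _ ≤ _ := by linarith

lemma continuous_integral_excessLoss (μ : Measure (EuclideanSpace ℝ (Fin d) × ℝ))
    [IsProbabilityMeasure μ] (hσc : Continuous σ) (hσ : ∀ t, σ t ∈ Set.Icc (0 : ℝ) 1)
    (hY : ∀ᵐ z ∂μ, z.2 ∈ Set.Icc (0 : ℝ) 1) :
    Continuous fun θ => ∫ z, excessLoss σ θ₀ θ z ∂μ :=
  continuous_of_dominated (bound := fun _ => 1)
    (fun θ => (measurable_excessLoss hσc θ).aestronglyMeasurable)
    (fun θ => by filter_upwards [hY] with z hz using abs_excessLoss_le hσ θ hz)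
    (integrable_const _) (ae_of_all _ fun z => continuous_excessLoss_apply hσc z)

lemma continuous_l1Norm : Continuous (l1Norm : EuclideanSpace ℝ (Fin d) → ℝ) := by
  unfold l1Norm
  fun_prop

/-- Deviations of the empirical excess loss over an `ℓ¹`-ball around `θ₀`. -/
lemma measure_pi_exists_lt_sum_excessLoss_le [NeZero d]
    (μ : Measure (EuclideanSpace ℝ (Fin d) × ℝ)) [IsProbabilityMeasure μ]
    (hσc : Continuous σ) (hσ : ∀ t, σ t ∈ Set.Icc (0 : ℝ) 1) {Mσ M : ℝ} (hMσ : 0 < Mσ)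
    (hM0 : 0 < M) (hL : ∀ a b, |σ a - σ b| ≤ Mσ * |a - b|)
    (hM : ∀ᵐ z ∂μ, ∀ j, |z.1 j| ≤ M) (hY : ∀ᵐ z ∂μ, z.2 ∈ Set.Icc (0 : ℝ) 1)
    {n : ℕ} (hn : 1 ≤ n) {r t : ℝ} (hr : 0 < r) (ht : 0 < t) :
    (Measure.pi fun _ : Fin n => μ) {z | ∃ θ, l1Norm (θ - θ₀) < r ∧
        t < ∑ i, (∫ z', excessLoss σ θ₀ θ z' ∂μ - excessLoss σ θ₀ θ (z i))} ≤
      ENNReal.ofReal (2 * d * Real.exp (-(t ^ 2 / (2 * n * (r * (2 * (2 * Mσ) * M)) ^ 2)))) := by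
  -- The conditions defining the event are strict and continuous in `θ`, so a violation anywhere
  -- forces one at a point of a countable dense sequence.
  let ι := {q : ℕ // l1Norm (TopologicalSpace.denseSeq (EuclideanSpace ℝ (Fin d)) q - θ₀) ≤ r}
  let p : ι → EuclideanSpace ℝ (Fin d) := fun q => TopologicalSpace.denseSeq _ q.1
  refine (measure_mono ?_).trans (measure_pi_exists_le_sum μ (X := Prod.fst) measurable_fst
    (ι := ι) (v := fun q => p q - θ₀) (f := fun q z => -excessLoss σ θ₀ (p q) z)
    (L := 2 * Mσ) (R := r) (by positivity) hr hM0 hM (fun q => q.2)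
    (fun q => (measurable_excessLoss hσc _).neg) ?_ ?_ hn ht)
  · rintro z ⟨θ, hθ, hθt⟩
    have ho : IsOpen {θ | l1Norm (θ - θ₀) < r ∧
        t < ∑ i, (∫ z', excessLoss σ θ₀ θ z' ∂μ - excessLoss σ θ₀ θ (z i))} := by
      refine IsOpen.and (isOpen_lt (continuous_l1Norm.comp (by fun_prop)) continuous_const)
        (isOpen_lt continuous_const (continuous_finsetSum _ fun i _ => ?_))
      exact (continuous_integral_excessLoss μ hσc hσ hY).sub (continuous_excessLoss_apply hσc _)
    obtain ⟨_, ⟨hq1, hq2⟩, q, rfl⟩ :=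
      (TopologicalSpace.denseRange_denseSeq _).inter_open_nonempty _ ho ⟨θ, hθ, hθt⟩
    refine ⟨⟨q, hq1.le⟩, hq2.le.trans (Finset.sum_le_sum fun i _ => ?_)⟩
    rw [integral_neg]
    simp only [p]
    linarith
  · filter_upwards [hY] with z hz q
    have := abs_excessLoss_sub_le (θ₀ := θ₀) hσ hL (p q) θ₀ hz
    rwa [excessLoss_self, sub_zero, ← inner_sub_right, ← abs_neg] at this
  · filter_upwards [hY] with z hz q q'
    have := abs_excessLoss_sub_le (θ₀ := θ₀) hσ hL (p q) (p q') hz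
    rw [← inner_sub_right, sub_sub_sub_cancel_right, inner_sub_right, neg_sub_neg, abs_sub_comm]
    exact this

/-- Uniformly over all `θ` at `ℓ¹`-distance at least `1 / n` from `θ₀`, the excess risk exceeds its
empirical counterpart by at most `lam / 2` times the distance, with high probability. -/
lemma measure_pi_exists_lt_excessRisk_sub_le [NeZero d]
    (μ : Measure (EuclideanSpace ℝ (Fin d) × ℝ)) [IsProbabilityMeasure μ]
    (hσc : Continuous σ) (hσ : ∀ t, σ t ∈ Set.Icc (0 : ℝ) 1) {Mσ M : ℝ} (hMσ : 0 < Mσ)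
    (hM0 : 0 < M) (hL : ∀ a b, |σ a - σ b| ≤ Mσ * |a - b|)
    (hM : ∀ᵐ z ∂μ, ∀ j, |z.1 j| ≤ M) (hY : ∀ᵐ z ∂μ, z.2 ∈ Set.Icc (0 : ℝ) 1)
    {n : ℕ} (hn : 1 ≤ n) {lam : ℝ}
    (hlam : lam = 96 * Mσ * M * Real.sqrt (Real.log (4 * (n : ℝ) * (d : ℝ)) / (n : ℝ)))
    (hlam2 : 2 ≤ lam / 2 * (2 ^ n / n)) :
    (Measure.pi fun _ : Fin n => μ) {z | ∃ θ, 1 / (n : ℝ) ≤ l1Norm (θ - θ₀) ∧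
        lam / 2 * l1Norm (θ - θ₀) <
          ∫ z', excessLoss σ θ₀ θ z' ∂μ - 1 / (n : ℝ) * ∑ i, excessLoss σ θ₀ θ (z i)} ≤
      ENNReal.ofReal (1 / n) := by
  have hn0 : (0 : ℝ) < n := by exact_mod_cast hn
  have hn1 : (1 : ℝ) ≤ n := by exact_mod_cast hn
  have hd1 : (1 : ℝ) ≤ d := by exact_mod_cast NeZero.one_le
  have hnd : (1 : ℝ) ≤ n * d := by nlinarith
  have hlog : 0 < Real.log (4 * n * d) := Real.log_pos (by nlinarith)
  have hlam0 : 0 < lam := by rw [hlam]; positivity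
  -- Dyadic shells: on `2 ^ k / n ≤ l1Norm (θ - θ₀) < 2 ^ (k + 1) / n` a violation exceeds the
  -- threshold at the inner radius. The constant `96` in `lam` makes each exponent `18 * log (4 * n
  -- * d)`, of which only `2 * log (4 * n * d)` is needed to sum over `n` shells.
  let S : ℕ → Set (Fin n → EuclideanSpace ℝ (Fin d) × ℝ) := fun k =>
    {z | ∃ θ, l1Norm (θ - θ₀) < 2 * (2 ^ k / n) ∧ n * (lam / 2 * (2 ^ k / n)) <
      ∑ i, (∫ z', excessLoss σ θ₀ θ z' ∂μ - excessLoss σ θ₀ θ (z i))}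
  have hS : ∀ k, (Measure.pi fun _ : Fin n => μ) (S k) ≤
      ENNReal.ofReal (2 * d * Real.exp (-(18 * Real.log (4 * n * d)))) := by
    intro k
    refine (measure_pi_exists_lt_sum_excessLoss_le μ hσc hσ hMσ hM0 hL hM hY hn (by positivity)
      (by positivity)).trans (le_of_eq ?_)
    congr 4
    have h2 : lam ^ 2 = (96 * Mσ * M) ^ 2 * (Real.log (4 * n * d) / n) := by
      rw [hlam, mul_pow, Real.sq_sqrt (by positivity)]
    have h3 : (n * (lam / 2 * (2 ^ k / n))) ^ 2 = lam ^ 2 * (2 ^ k / 2) ^ 2 := by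
      field_simp
    rw [h3, h2]
    field_simp
    norm_num
  have hae : ∀ᵐ z ∂(Measure.pi fun _ : Fin n => μ), ∀ i, (z i).2 ∈ Set.Icc (0 : ℝ) 1 := by
    rw [ae_all_iff]
    intro i
    exact (measurePreserving_eval (fun _ : Fin n => μ) i).quasiMeasurePreserving.ae hY
  calc _ ≤ (Measure.pi fun _ : Fin n => μ) (⋃ k ∈ Finset.range n, S k) := by
        refine measure_mono_ae ?_
        filter_upwards [hae] with z hz
        rintro ⟨θ, hθ1, hθ2⟩
        have hsum : ∑ i, (∫ z', excessLoss σ θ₀ θ z' ∂μ - excessLoss σ θ₀ θ (z i)) =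
            n * (∫ z', excessLoss σ θ₀ θ z' ∂μ - 1 / (n : ℝ) * ∑ i, excessLoss σ θ₀ θ (z i)) := by
          rw [Finset.sum_sub_distrib]
          simp
          field_simp
        have hle : ∫ z', excessLoss σ θ₀ θ z' ∂μ -
            1 / (n : ℝ) * ∑ i, excessLoss σ θ₀ θ (z i) ≤ 2 := by
          have h1 : ∫ z', excessLoss σ θ₀ θ z' ∂μ ≤ 1 := by
            have := norm_integral_le_of_norm_le_const (μ := μ) (f := excessLoss σ θ₀ θ) (C := 1)
              (by filter_upwards [hY] with z hz using abs_excessLoss_le hσ θ hz)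
            simp only [probReal_univ, mul_one] at this
            exact le_of_abs_le this
          have h2 : ∑ i : Fin n, (-1 : ℝ) ≤ ∑ i, excessLoss σ θ₀ θ (z i) :=
            Finset.sum_le_sum fun i _ => neg_le_of_abs_le (abs_excessLoss_le hσ θ (hz i))
          simp only [Finset.sum_const, Finset.card_univ, Fintype.card_fin, smul_neg,
            nsmul_eq_mul, mul_one] at h2
          have h3 : 1 / (n : ℝ) * (-n) ≤ 1 / (n : ℝ) * ∑ i, excessLoss σ θ₀ θ (z i) := by gcongr
          have h4 : 1 / (n : ℝ) * (-n) = -1 := by field_simp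
          linarith
        -- Beyond radius `2 ^ n / n` the linear margin is at least `2`, which bounded losses cannot
        -- exceed; hence `n` shells suffice.
        have hlt : l1Norm (θ - θ₀) < 2 ^ n / n := by
          by_contra! hc
          have := mul_le_mul_of_nonneg_left hc (half_pos hlam0).le
          linarith
        have hx1 : 1 ≤ n * l1Norm (θ - θ₀) := by
          rw [div_le_iff₀ hn0] at hθ1; linarith
        obtain ⟨k, hk1, hk2⟩ := exists_nat_pow_near hx1 one_lt_two
        have hkn : k < n := by
          rw [lt_div_iff₀ hn0] at hlt
          have : (2 : ℝ) ^ k < 2 ^ n := by linarith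
          exact (pow_lt_pow_iff_right₀ one_lt_two).1 this
        refine Set.mem_biUnion (Finset.mem_coe.2 (Finset.mem_range.2 hkn)) ⟨θ, ?_, ?_⟩
        · rw [← mul_div_assoc, lt_div_iff₀ hn0]
          rw [pow_succ] at hk2
          linarith
        · rw [hsum]
          refine mul_lt_mul_of_pos_left (lt_of_le_of_lt ?_ hθ2) hn0
          refine mul_le_mul_of_nonneg_left ?_ (half_pos hlam0).le
          rw [div_le_iff₀ hn0]
          linarith
    _ ≤ ∑ k ∈ Finset.range n, (Measure.pi fun _ : Fin n => μ) (S k) :=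
        measure_biUnion_finset_le _ _
    _ ≤ ∑ k ∈ Finset.range n,
          ENNReal.ofReal (2 * d * Real.exp (-(18 * Real.log (4 * n * d)))) :=
        Finset.sum_le_sum fun k _ => hS k
    _ ≤ _ := by
        rw [Finset.sum_const, Finset.card_range, nsmul_eq_mul, ← ENNReal.ofReal_natCast,
          ← ENNReal.ofReal_mul (by positivity)]
        refine ENNReal.ofReal_le_ofReal ?_
        have h1 : Real.exp (-(18 * Real.log (4 * n * d))) ≤ 1 / (4 * n * d) ^ 2 := by
          have : Real.exp (2 * Real.log (4 * n * d)) = (4 * n * d) ^ 2 := by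
            rw [mul_comm, Real.exp_mul, Real.exp_log (by positivity)]; norm_cast
          rw [one_div, ← this, ← Real.exp_neg]
          exact Real.exp_le_exp.2 (by linarith)
        calc (n : ℝ) * (2 * d * Real.exp (-(18 * Real.log (4 * n * d))))
            ≤ n * (2 * d * (1 / (4 * n * d) ^ 2)) := by gcongr
          _ = 1 / (8 * n * d) := by field_simp; norm_num
          _ ≤ 1 / n := by
            apply one_div_le_one_div_of_le hn0
            nlinarith

end ExcessLoss

/-! ### From eigenvalues to the quadratic form -/

lemma hasEigenvalue_toLin'_of_mem_spectrum {d : ℕ} {A : Matrix (Fin d) (Fin d) ℝ} {μ : ℝ}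
    (h : μ ∈ spectrum ℝ A) : Module.End.HasEigenvalue (Matrix.toLin' A) μ := by
  rw [Module.End.hasEigenvalue_iff_mem_spectrum]
  rwa [Matrix.spectrum_toLin']

/-- A real symmetric matrix whose eigenvalues are at least `ρ` has a quadratic form at least `ρ`. -/
lemma Matrix.IsHermitian.le_dotProduct_mulVec {d : ℕ} {A : Matrix (Fin d) (Fin d) ℝ}
    (hA : A.IsHermitian) {ρ : ℝ}
    (h : ∀ μ : ℝ, Module.End.HasEigenvalue (Matrix.toLin' A) μ → ρ ≤ μ) (v : Fin d → ℝ) :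
    ρ * ∑ j, v j ^ 2 ≤ v ⬝ᵥ (A.mulVec v) := by
  have hB : (A - ρ • (1 : Matrix (Fin d) (Fin d) ℝ)).IsHermitian := by
    refine hA.sub ?_
    ext i j
    simp [Matrix.one_apply, eq_comm]
  have hpos : (A - ρ • (1 : Matrix (Fin d) (Fin d) ℝ)).PosSemidef := by
    rw [hB.posSemidef_iff_eigenvalues_nonneg]
    intro i
    have h1 := hB.eigenvalues_mem_spectrum_real i
    have h2 : hB.eigenvalues i + ρ ∈ spectrum ℝ A := by
      generalize hB.eigenvalues i = μ at h1
      rw [← Algebra.algebraMap_eq_smul_one, ← spectrum.sub_singleton_eq] at h1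
      obtain ⟨a, ha, b, hb, hab⟩ := h1
      rw [Set.mem_singleton_iff] at hb
      simp only at hab
      rw [← hab, hb, sub_add_cancel]
      exact ha
    have := h _ (hasEigenvalue_toLin'_of_mem_spectrum h2)
    simp only [Pi.zero_apply]
    linarith
  have := hpos.dotProduct_mulVec_nonneg v
  simp only [star_trivial, Matrix.sub_mulVec, Matrix.smul_mulVec, Matrix.one_mulVec,
    dotProduct_sub, dotProduct_smul, smul_eq_mul] at this
  have e : v ⬝ᵥ v = ∑ j, v j ^ 2 := by simp [dotProduct, pow_two]
  rw [e] at this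
  linarith

/-! ### Polynomial minorants for the squared increment of the link -/

/-- With `u = τ * w`, the bound by `1` is `(u ^ 2 - 2) ^ 2 ≥ 0`. A polynomial minorant of the
truncated square needs only second and fourth moments; the dilation `τ` is kept free to control the
quartic term when `w` is large. -/
lemma sq_sub_quartic_le_min {w τ : ℝ} (h0 : 0 ≤ τ) (h1 : τ ≤ 1) :
    τ ^ 2 * w ^ 2 - τ ^ 4 * w ^ 4 / 4 ≤ min (w ^ 2) 1 := by
  have hw := sq_nonneg w
  have e : τ ^ 4 * w ^ 4 = (τ ^ 2 * w ^ 2) ^ 2 := by ring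
  rw [e]
  have h2 : τ ^ 2 ≤ 1 := by nlinarith
  refine le_min ?_ ?_
  · nlinarith [sq_nonneg (τ ^ 2 * w ^ 2)]
  · nlinarith [sq_nonneg (τ ^ 2 * w ^ 2 - 2)]

section Link

variable {σ : ℝ → ℝ}

lemma strictMono_of_deriv_lower_bound
    (hσ_inf : ∀ s : ℝ, 0 < s → ∃ c : ℝ, 0 < c ∧ ∀ t : ℝ, |t| ≤ s → c ≤ deriv σ t) :
    StrictMono σ := by
  refine strictMono_of_deriv_pos fun t => ?_
  obtain ⟨c, hc, h⟩ := hσ_inf (|t| + 1) (by positivity)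
  exact hc.trans_le (h t (by linarith))

/-- From a point of `[-T, T]` a move of length at most `1` stays where the slope is at least `c`;
monotonicity handles the rest of the move. -/
lemma mul_min_le_abs_sub (hσ : Differentiable ℝ σ) (hmono : Monotone σ) {T c : ℝ}
    (hc : ∀ t : ℝ, |t| ≤ T + 1 → c ≤ deriv σ t) {a : ℝ} (ha : |a| ≤ T) (w : ℝ) :
    c * min |w| 1 ≤ |σ (a + w) - σ a| := by
  have ha' := abs_le.1 ha
  have key : ∀ x ∈ Set.Icc (-(T + 1)) (T + 1), ∀ y ∈ Set.Icc (-(T + 1)) (T + 1), x ≤ y →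
      c * (y - x) ≤ σ y - σ x :=
    (convex_Icc _ _).mul_sub_le_image_sub_of_le_deriv hσ.continuous.continuousOn
      hσ.differentiableOn (fun x hx => hc x (by
        rw [interior_Icc] at hx
        exact abs_le.2 ⟨hx.1.le, hx.2.le⟩))
  have hm1 : min |w| 1 ≤ 1 := min_le_right _ _
  have hm2 : min |w| 1 ≤ |w| := min_le_left _ _
  have hm0 : 0 ≤ min |w| 1 := by positivity
  rcases le_total 0 w with hw | hw
  · rw [abs_of_nonneg hw] at *
    have h1 := key a ⟨by linarith, by linarith⟩ (a + min w 1) ⟨by linarith, by linarith⟩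
      (by linarith)
    have h2 := hmono (show a + min w 1 ≤ a + w by linarith)
    refine le_trans ?_ (le_abs_self _)
    rw [add_sub_cancel_left] at h1
    linarith
  · rw [abs_of_nonpos hw] at *
    have h1 := key (a - min (-w) 1) ⟨by linarith, by linarith⟩ a ⟨by linarith, by linarith⟩
      (by linarith)
    have h2 := hmono (show a + w ≤ a - min (-w) 1 by linarith)
    refine le_trans ?_ (neg_le_abs _)
    rw [sub_sub_cancel] at h1
    linarith

/-- For `|a| ≤ T` this is the truncated slope bound. For `|a| > T` the left side is nonpositive,
because `w ^ 2 ≤ w ^ 2 * a ^ 2 / T ^ 2` and the mixed term is split into fourth powers with weight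
`α`. -/
lemma quartic_le_sq_sub (hσ : Differentiable ℝ σ) (hmono : Monotone σ) {T c : ℝ} (hc0 : 0 ≤ c)
    (hT : 0 < T) (hc : ∀ t : ℝ, |t| ≤ T + 1 → c ≤ deriv σ t) {τ : ℝ} (h0 : 0 ≤ τ) (h1 : τ ≤ 1)
    {α : ℝ} (hα : 0 < α) (a w : ℝ) :
    c ^ 2 * (τ ^ 2 * w ^ 2 - τ ^ 4 / 4 * w ^ 4 -
      τ ^ 2 / (2 * T ^ 2) * (α⁻¹ * w ^ 4 + α * a ^ 4)) ≤ (σ (a + w) - σ a) ^ 2 := by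
  have hamgm : 2 * (w ^ 2 * a ^ 2) ≤ α⁻¹ * w ^ 4 + α * a ^ 4 := by
    have : α⁻¹ * w ^ 4 + α * a ^ 4 - 2 * (w ^ 2 * a ^ 2) = α⁻¹ * (w ^ 2 - α * a ^ 2) ^ 2 := by
      field_simp; ring
    have h : 0 ≤ α⁻¹ * (w ^ 2 - α * a ^ 2) ^ 2 := by positivity
    linarith
  have h2 : τ ^ 2 / T ^ 2 * (w ^ 2 * a ^ 2) ≤
      τ ^ 2 / (2 * T ^ 2) * (α⁻¹ * w ^ 4 + α * a ^ 4) := by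
    have := mul_le_mul_of_nonneg_left hamgm (show 0 ≤ τ ^ 2 / (2 * T ^ 2) by positivity)
    refine le_trans (le_of_eq ?_) this
    field_simp
  have h3 : 0 ≤ τ ^ 2 / T ^ 2 * (w ^ 2 * a ^ 2) := by positivity
  rcases le_or_gt |a| T with ha | ha
  · have hm := mul_min_le_abs_sub hσ hmono hc ha w
    have hsq : (c * min |w| 1) ^ 2 ≤ (σ (a + w) - σ a) ^ 2 := by
      rw [← sq_abs (σ (a + w) - σ a)]
      exact pow_le_pow_left₀ (by positivity) hm 2
    refine le_trans ?_ hsq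
    rw [mul_pow]
    refine mul_le_mul_of_nonneg_left ?_ (sq_nonneg c)
    have e : (min |w| 1) ^ 2 = min (w ^ 2) 1 := by
      rcases le_total |w| 1 with hw | hw
      · rw [min_eq_left hw, sq_abs, min_eq_left ((sq_le_one_iff_abs_le_one w).2 hw)]
      · rw [min_eq_right hw, min_eq_right ((one_le_sq_iff_one_le_abs w).2 hw), one_pow]
    rw [e]
    have := sq_sub_quartic_le_min (w := w) h0 h1
    linarith
  · refine le_trans ?_ (sq_nonneg _)
    refine mul_nonpos_of_nonneg_of_nonpos (sq_nonneg c) ?_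
    have h4 : τ ^ 2 * w ^ 2 ≤ τ ^ 2 / T ^ 2 * (w ^ 2 * a ^ 2) := by
      have ha2 : T ^ 2 ≤ a ^ 2 := by
        rw [← sq_abs a]; exact pow_le_pow_left₀ hT.le ha.le 2
      have e : τ ^ 2 / T ^ 2 * (w ^ 2 * a ^ 2) = τ ^ 2 * w ^ 2 * (a ^ 2 / T ^ 2) := by
        field_simp
      rw [e]
      exact le_mul_of_one_le_right (by positivity) ((one_le_div (by positivity)).2 ha2)
    have h5 : 0 ≤ τ ^ 4 / 4 * w ^ 4 := by positivity
    linarith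

lemma abs_sub_le_of_deriv_le {Mσ : ℝ} (hσ : Differentiable ℝ σ) (hmono : Monotone σ)
    (hσ_sup : ∀ t, deriv σ t ≤ Mσ) (a b : ℝ) : |σ a - σ b| ≤ Mσ * |a - b| := by
  refine (convex_univ).norm_image_sub_le_of_norm_deriv_le (f := σ) (fun x _ => hσ x)
    (fun x _ => ?_) (Set.mem_univ b) (Set.mem_univ a)
  rw [Real.norm_eq_abs, abs_of_nonneg hmono.deriv_nonneg]
  exact hσ_sup x

end Link

/-! ### Second and fourth moments of linear forms of the covariates -/

section Covariates

variable {Ω : Type*} [MeasurableSpace Ω] {d : ℕ} {P : Measure Ω}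
  {X : Ω → EuclideanSpace ℝ (Fin d)} {M ρ : ℝ}

lemma RegularCovariates.ae_abs_inner_le (hX : RegularCovariates P X M ρ)
    (v : EuclideanSpace ℝ (Fin d)) : ∀ᵐ ω ∂P, |inner ℝ (X ω) v| ≤ M * l1Norm v := by
  filter_upwards [hX.bounded] with ω hω using abs_inner_le_mul_l1Norm hω

variable [IsProbabilityMeasure P]

lemma RegularCovariates.integrable_inner_pow (hX : RegularCovariates P X M ρ)
    (hm : Measurable X) (v : EuclideanSpace ℝ (Fin d)) (k : ℕ) :
    Integrable (fun ω => inner ℝ (X ω) v ^ k) P := by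
  refine Integrable.of_bound (by fun_prop) ((M * l1Norm v) ^ k) ?_
  filter_upwards [hX.ae_abs_inner_le v] with ω hω
  rw [norm_pow, Real.norm_eq_abs]
  exact pow_le_pow_left₀ (abs_nonneg _) hω k

lemma RegularCovariates.mul_norm_sq_le_integral (hX : RegularCovariates P X M ρ)
    (hm : Measurable X) (v : EuclideanSpace ℝ (Fin d)) :
    ρ * ‖v‖ ^ 2 ≤ ∫ ω, inner ℝ (X ω) v ^ 2 ∂P := by
  have hA : (secondMoment P X).IsHermitian := by
    ext i j
    simp [secondMoment, mul_comm]
  have h := hA.le_dotProduct_mulVec hX.eigenvalue_ge v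
  rw [EuclideanSpace.real_norm_sq_eq]
  refine h.trans (le_of_eq ?_)
  have hint : ∀ j k, Integrable (fun ω => v j * (X ω j * X ω k * v k)) P := by
    intro j k
    have : Integrable (fun ω => X ω j * X ω k) P := by
      refine Integrable.of_bound (by fun_prop) (M * M) ?_
      filter_upwards [hX.bounded] with ω hω
      rw [norm_mul]
      exact mul_le_mul (hω j) (hω k) (norm_nonneg _) ((abs_nonneg _).trans (hω j))
    exact (this.mul_const _).const_mul _
  have e : ∀ ω, inner ℝ (X ω) v ^ 2 = ∑ j, ∑ k, v j * (X ω j * X ω k * v k) := by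
    intro ω
    rw [inner_eq_sum_mul, pow_two, Finset.sum_mul_sum]
    refine Finset.sum_congr rfl fun j _ => Finset.sum_congr rfl fun k _ => by ring
  simp_rw [e]
  rw [integral_finsetSum _ fun j _ => integrable_finsetSum _ fun k _ => hint j k]
  simp only [dotProduct, Matrix.mulVec, Finset.mul_sum]
  refine Finset.sum_congr rfl fun j _ => ?_
  rw [integral_finsetSum _ fun k _ => hint j k]
  refine Finset.sum_congr rfl fun k _ => ?_
  rw [integral_const_mul, integral_mul_const]
  simp [secondMoment]

lemma RegularCovariates.integrable_exp_inner (hX : RegularCovariates P X M ρ)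
    (hm : Measurable X) (v : EuclideanSpace ℝ (Fin d)) :
    Integrable (fun ω => Real.exp (inner ℝ (X ω) v)) P := by
  refine Integrable.of_bound (by fun_prop) (Real.exp (M * l1Norm v)) ?_
  filter_upwards [hX.ae_abs_inner_le v] with ω hω
  rw [Real.norm_eq_abs, abs_of_pos (Real.exp_pos _)]
  exact Real.exp_le_exp.2 (le_of_abs_le hω)

lemma pow_four_le_exp_add_exp_neg (x : ℝ) : x ^ 4 ≤ 24 * (Real.exp x + Real.exp (-x)) := by
  have h := Real.pow_div_factorial_le_exp |x| (abs_nonneg x) 4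
  have e : |x| ^ 4 = x ^ 4 := by rw [pow_abs, abs_of_nonneg (by positivity)]
  have h2 : Real.exp |x| ≤ Real.exp x + Real.exp (-x) := by
    rcases abs_cases x with h | h <;> rw [h.1] <;> linarith [Real.exp_pos x, Real.exp_pos (-x)]
  rw [e] at h
  norm_num [Nat.factorial] at h
  linarith

/-- By homogeneity it suffices to treat unit vectors, where `x ^ 4 ≤ 4! * (e^x + e^(-x))` and the
sub-Gaussian bound in both directions apply. -/
lemma RegularCovariates.integral_inner_pow_four_le (hX : RegularCovariates P X M ρ)
    (hm : Measurable X) (v : EuclideanSpace ℝ (Fin d)) :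
    ∫ ω, inner ℝ (X ω) v ^ 4 ∂P ≤ 48 * Real.exp (M ^ 2 / 2) * ‖v‖ ^ 4 := by
  rcases eq_or_ne v 0 with rfl | hv
  · simp
  have hv0 : ‖v‖ ≠ 0 := norm_ne_zero_iff.2 hv
  set u := ‖v‖⁻¹ • v with hu
  have hu1 : ‖u‖ = 1 := by rw [hu, norm_smul, norm_inv, norm_norm, inv_mul_cancel₀ hv0]
  have hvu : v = ‖v‖ • u := by rw [hu, smul_smul, mul_inv_cancel₀ hv0, one_smul]
  have h1 := hX.subgaussian u
  have h2 := hX.subgaussian (-u)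
  rw [norm_neg] at h2
  rw [hu1] at h1 h2
  have h3 : ∫ ω, inner ℝ (X ω) u ^ 4 ∂P ≤ ∫ ω, 24 * (Real.exp (inner ℝ (X ω) u) +
      Real.exp (inner ℝ (X ω) (-u))) ∂P := by
    refine integral_mono (hX.integrable_inner_pow hm u 4)
      (((hX.integrable_exp_inner hm u).add (hX.integrable_exp_inner hm (-u))).const_mul _)
      fun ω => ?_
    have := pow_four_le_exp_add_exp_neg (inner ℝ (X ω) u)
    rwa [inner_neg_right]
  rw [integral_const_mul, integral_add (hX.integrable_exp_inner hm u)
    (hX.integrable_exp_inner hm (-u))] at h3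
  have h4 : ∫ ω, inner ℝ (X ω) v ^ 4 ∂P = ‖v‖ ^ 4 * ∫ ω, inner ℝ (X ω) u ^ 4 ∂P := by
    rw [← integral_const_mul]
    refine integral_congr_ae (ae_of_all _ fun ω => ?_)
    simp only
    conv_lhs => rw [hvu, real_inner_smul_right, mul_pow]
  rw [h4, mul_comm]
  refine mul_le_mul_of_nonneg_right ?_ (by positivity)
  rw [one_pow, mul_one] at h1 h2
  linarith

end Covariates

-- Curvature of the excess risk

universe u

/-- The excess risk dominates the squared Euclidean distance to the true parameter, truncated at
`1`, with a constant that does not depend on the dimension. -/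
lemma exists_mul_min_le_integral_sq_sub {σ : ℝ → ℝ} {M ρ M₀ : ℝ} (hρ : 0 < ρ)
    (hσ_diff : Differentiable ℝ σ) (hσ : ∀ t, σ t ∈ Set.Icc (0 : ℝ) 1)
    (hσ_inf : ∀ s : ℝ, 0 < s → ∃ c : ℝ, 0 < c ∧ ∀ t : ℝ, |t| ≤ s → c ≤ deriv σ t) :
    ∃ c : ℝ, 0 < c ∧ ∀ {Ω : Type u} [MeasurableSpace Ω] {d : ℕ} (P : Measure Ω)
      [IsProbabilityMeasure P] (X : Ω → EuclideanSpace ℝ (Fin d)), Measurable X →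
      RegularCovariates P X M ρ → ∀ θ₀ θ : EuclideanSpace ℝ (Fin d), ‖θ₀‖ ≤ M₀ →
      c * min (‖θ - θ₀‖ ^ 2) 1 ≤
        ∫ ω, (σ (inner ℝ (X ω) θ) - σ (inner ℝ (X ω) θ₀)) ^ 2 ∂P := by
  set C := 48 * Real.exp (M ^ 2 / 2) with hC
  have hC0 : 0 < C := by positivity
  -- `T` and `η` are tuned so that the loss from `|Xᵀθ₀| > T` and the quartic loss each use at most
  -- `ρ / 4` of the quadratic term, leaving `ρ / 2`.
  set T := Real.sqrt (2 * C * (1 + M₀ ^ 4) / ρ) with hT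
  have hT0 : 0 < T := Real.sqrt_pos.2 (by positivity)
  have hT2 : T ^ 2 = 2 * C * (1 + M₀ ^ 4) / ρ := Real.sq_sqrt (by positivity)
  obtain ⟨b, hb0, hb⟩ := hσ_inf (T + 1) (by positivity)
  set η := Real.sqrt (ρ / C) with hη
  have hη0 : 0 < η := Real.sqrt_pos.2 (by positivity)
  have hη2 : η ^ 2 = ρ / C := Real.sq_sqrt (by positivity)
  refine ⟨b ^ 2 * (ρ / 2) * min 1 (η ^ 2), by positivity, ?_⟩
  intro Ω _ d P _ X hm hX θ₀ θ hθ₀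
  rcases eq_or_ne θ θ₀ with rfl | hne
  · simp
  set v := θ - θ₀ with hv
  have hδ0 : 0 < ‖v‖ := norm_pos_iff.2 (sub_ne_zero.2 hne)
  set δ := ‖v‖ with hδ
  -- The dilation caps the effective distance `τ * δ` at `η`, which is where truncation of the
  -- squared distance comes from. The weight `α = δ ^ 2` below makes both fourth-moment terms of
  -- order `δ ^ 2`.
  set τ := min 1 (η / δ) with hτ
  have hτ0 : 0 < τ := by positivity
  have hτ1 : τ ≤ 1 := min_le_left _ _
  have hτδ : τ * δ = min δ η := by
    rw [hτ, min_mul_of_nonneg _ _ hδ0.le, one_mul, div_mul_cancel₀ _ hδ0.ne']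
  have hi2 := hX.integrable_inner_pow hm v 2
  have hi4 := hX.integrable_inner_pow hm v 4
  have hi0 := hX.integrable_inner_pow hm θ₀ 4
  have hl2 := hX.mul_norm_sq_le_integral hm v
  have hl4 := hX.integral_inner_pow_four_le hm v
  have hl0 := hX.integral_inner_pow_four_le hm θ₀
  have hl0' : ∫ ω, inner ℝ (X ω) θ₀ ^ 4 ∂P ≤ C * M₀ ^ 4 :=
    hl0.trans (mul_le_mul_of_nonneg_left (pow_le_pow_left₀ (norm_nonneg _) hθ₀ 4) hC0.le)
  have hmono := (strictMono_of_deriv_lower_bound hσ_inf).monotone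
  have hα : 0 < δ ^ 2 := by positivity
  have hint : ∫ ω, b ^ 2 * (τ ^ 2 * inner ℝ (X ω) v ^ 2 - τ ^ 4 / 4 * inner ℝ (X ω) v ^ 4 -
      τ ^ 2 / (2 * T ^ 2) * ((δ ^ 2)⁻¹ * inner ℝ (X ω) v ^ 4 +
        δ ^ 2 * inner ℝ (X ω) θ₀ ^ 4)) ∂P ≤
      ∫ ω, (σ (inner ℝ (X ω) θ) - σ (inner ℝ (X ω) θ₀)) ^ 2 ∂P := by
    refine integral_mono ?_ ?_ fun ω => ?_
    · exact (((hi2.const_mul _).sub (hi4.const_mul _)).sub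
        (((hi4.const_mul _).add (hi0.const_mul _)).const_mul _)).const_mul _
    · have := hσ_diff.continuous.measurable
      refine Integrable.of_bound (by fun_prop) 1 (ae_of_all _ fun ω => ?_)
      have h1 := hσ (inner ℝ (X ω) θ)
      have h2 := hσ (inner ℝ (X ω) θ₀)
      rw [Real.norm_eq_abs, abs_of_nonneg (sq_nonneg _), sq_le_one_iff_abs_le_one, abs_le]
      exact ⟨by linarith [h1.1, h2.2], by linarith [h1.2, h2.1]⟩
    · have := quartic_le_sq_sub hσ_diff hmono hb0.le hT0 hb hτ0.le hτ1 hα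
        (inner ℝ (X ω) θ₀) (inner ℝ (X ω) v)
      rwa [← inner_add_right, hv, add_sub_cancel] at this
  refine le_trans ?_ hint
  have hs1 : Integrable (fun ω => τ ^ 2 * inner ℝ (X ω) v ^ 2 -
      τ ^ 4 / 4 * inner ℝ (X ω) v ^ 4) P := (hi2.const_mul _).sub (hi4.const_mul _)
  have hs2 : Integrable (fun ω => (δ ^ 2)⁻¹ * inner ℝ (X ω) v ^ 4 +
      δ ^ 2 * inner ℝ (X ω) θ₀ ^ 4) P := (hi4.const_mul _).add (hi0.const_mul _)
  rw [integral_const_mul, integral_sub hs1 (hs2.const_mul _), integral_sub (hi2.const_mul _) (hi4.const_mul _), integral_const_mul, integral_const_mul,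
    integral_const_mul, integral_add (hi4.const_mul _) (hi0.const_mul _), integral_const_mul,
    integral_const_mul]
  have h1 : τ ^ 2 / (2 * T ^ 2) * ((δ ^ 2)⁻¹ * ∫ ω, inner ℝ (X ω) v ^ 4 ∂P +
      δ ^ 2 * ∫ ω, inner ℝ (X ω) θ₀ ^ 4 ∂P) ≤ (τ * δ) ^ 2 * (ρ / 4) := by
    calc _ ≤ τ ^ 2 / (2 * T ^ 2) * ((δ ^ 2)⁻¹ * (C * δ ^ 4) + δ ^ 2 * (C * M₀ ^ 4)) := by
          gcongr
      _ = _ := by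
          have : (1 + M₀ ^ 4) ≠ 0 := by positivity
          rw [hT2]; field_simp; ring
  have h2 : τ ^ 4 / 4 * ∫ ω, inner ℝ (X ω) v ^ 4 ∂P ≤ (τ * δ) ^ 2 * (ρ / 4) := by
    have h3 : (τ * δ) ^ 2 ≤ ρ / C := by
      rw [← hη2, hτδ]
      exact pow_le_pow_left₀ (by positivity) (min_le_right _ _) 2
    calc _ ≤ τ ^ 4 / 4 * (C * δ ^ 4) := by gcongr
      _ = (τ * δ) ^ 2 * ((τ * δ) ^ 2 * C / 4) := by ring
      _ ≤ (τ * δ) ^ 2 * (ρ / C * C / 4) := by gcongr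
      _ = _ := by field_simp
  have h3 : (τ * δ) ^ 2 * ρ ≤ τ ^ 2 * ∫ ω, inner ℝ (X ω) v ^ 2 ∂P := by
    have := mul_le_mul_of_nonneg_left hl2 (sq_nonneg τ)
    linarith
  have h4 : min 1 (η ^ 2) * min (δ ^ 2) 1 ≤ (τ * δ) ^ 2 := by
    rw [hτδ]
    have a0 : 0 ≤ min 1 (η ^ 2) := by positivity
    have a1 : min 1 (η ^ 2) ≤ 1 := min_le_left _ _
    have a2 : min 1 (η ^ 2) ≤ η ^ 2 := min_le_right _ _
    have b0 : 0 ≤ min (δ ^ 2) 1 := by positivity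
    have b1 : min (δ ^ 2) 1 ≤ δ ^ 2 := min_le_left _ _
    have b2 : min (δ ^ 2) 1 ≤ 1 := min_le_right _ _
    rcases min_choice δ η with h | h <;> rw [h] <;> nlinarith
  have h5 : b ^ 2 * ((τ * δ) ^ 2 * (ρ / 2)) ≤ b ^ 2 * (τ ^ 2 * ∫ ω, inner ℝ (X ω) v ^ 2 ∂P -
      τ ^ 4 / 4 * ∫ ω, inner ℝ (X ω) v ^ 4 ∂P - τ ^ 2 / (2 * T ^ 2) *
      ((δ ^ 2)⁻¹ * ∫ ω, inner ℝ (X ω) v ^ 4 ∂P + δ ^ 2 * ∫ ω, inner ℝ (X ω) θ₀ ^ 4 ∂P)) :=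
    mul_le_mul_of_nonneg_left (by linarith) (sq_nonneg b)
  refine le_trans ?_ h5
  rw [mul_assoc (b ^ 2), mul_assoc (b ^ 2)]
  refine mul_le_mul_of_nonneg_left ?_ (sq_nonneg b)
  have := mul_le_mul_of_nonneg_left h4 (half_pos hρ).le
  linarith

/-- In the binary model the expected excess loss is the mean squared error of the link. -/
lemma BinaryModel.integral_excessLoss_map {Ω : Type*} [MeasurableSpace Ω] {d : ℕ} {P : Measure Ω}
    [IsProbabilityMeasure P] {X : Ω → EuclideanSpace ℝ (Fin d)} {Y : Ω → ℝ} {σ : ℝ → ℝ}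
    {θ₀ : EuclideanSpace ℝ (Fin d)} (h : BinaryModel P X Y σ θ₀) (hσc : Continuous σ)
    (hσ : ∀ t, σ t ∈ Set.Icc (0 : ℝ) 1) (θ : EuclideanSpace ℝ (Fin d)) :
    ∫ z, excessLoss σ θ₀ θ z ∂(P.map fun ω => (X ω, Y ω)) =
      ∫ ω, (σ (inner ℝ (X ω) θ) - σ (inner ℝ (X ω) θ₀)) ^ 2 ∂P := by
  have hX := h.measurable_X
  have hY := h.measurable_Y
  have hσm := hσc.measurable
  rw [integral_map (by fun_prop) (measurable_excessLoss hσc θ).aestronglyMeasurable]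
  set p : Ω → ℝ := fun ω => σ (inner ℝ (X ω) θ₀) with hp
  set q : Ω → ℝ := fun ω => σ (inner ℝ (X ω) θ) with hq
  set I : Ω → ℝ := (Y ⁻¹' {1}).indicator fun _ => 1 with hI
  have hset : MeasurableSet (Y ⁻¹' {1}) := hY (measurableSet_singleton 1)
  have hbd : ∀ ω, |p ω - q ω| ≤ 1 := fun ω => by
    have h1 := hσ (inner ℝ (X ω) θ)
    have h2 := hσ (inner ℝ (X ω) θ₀)
    rw [abs_le]
    exact ⟨by linarith [h1.2, h2.1], by linarith [h1.1, h2.2]⟩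
  have hIi : Integrable I P := (integrable_const (1 : ℝ)).indicator hset
  have hpqI : Integrable (fun ω => (p ω - q ω) * I ω) P :=
    hIi.bdd_mul (c := 1) (by fun_prop) (ae_of_all _ hbd)
  have hpm : Integrable p P := Integrable.of_bound (by fun_prop) 1 (ae_of_all _ fun ω => by
    rw [Real.norm_eq_abs, abs_of_nonneg (hσ _).1]; exact (hσ _).2)
  have hpqp : Integrable (fun ω => (p ω - q ω) * p ω) P :=
    hpm.bdd_mul (c := 1) (by fun_prop) (ae_of_all _ hbd)
  have hsm : StronglyMeasurable[MeasurableSpace.comap X inferInstance]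
      (fun ω => p ω - q ω) := by
    have hg : Measurable fun x : EuclideanSpace ℝ (Fin d) =>
        σ (inner ℝ x θ₀) - σ (inner ℝ x θ) := by fun_prop
    exact (hg.comp (comap_measurable X)).stronglyMeasurable
  have hce := condExp_mul_of_stronglyMeasurable_left hsm hpqI hIi
  -- Orthogonality of the noise: `p - q` is a function of `X`, and the conditional expectation of
  -- `I` given `X` is `p`. The cross term of the expanded square therefore integrates to zero.
  have horth : ∫ ω, (p ω - q ω) * I ω ∂P = ∫ ω, (p ω - q ω) * p ω ∂P := by
    have h1 := integral_condExp (μ := P) (f := (fun ω => p ω - q ω) * I) hX.comap_le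
    have h2 : ∫ ω, ((fun ω => p ω - q ω) * I) ω ∂P = ∫ ω, (p ω - q ω) * I ω ∂P := rfl
    rw [← h2, ← h1]
    refine integral_congr_ae ?_
    filter_upwards [hce, h.condProb] with ω h3 h4
    rw [h3, Pi.mul_apply, h4]
  have hae : ∀ᵐ ω ∂P, excessLoss σ θ₀ θ (X ω, Y ω) =
      (q ω - p ω) ^ 2 + 2 * ((p ω - q ω) * I ω - (p ω - q ω) * p ω) := by
    filter_upwards [h.binary] with ω hω
    have : I ω = Y ω := by
      rcases hω with h0 | h1
      · rw [hI, Set.indicator_of_notMem (by simp [h0]), h0]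
      · rw [hI, Set.indicator_of_mem (by simp [h1]), h1]
    rw [this]
    simp only [excessLoss, hp, hq]
    ring
  rw [integral_congr_ae hae, integral_add, integral_const_mul, integral_sub hpqI hpqp, horth]
  · rw [sub_self, mul_zero, add_zero]
  · refine Integrable.of_bound (by fun_prop) 1 (ae_of_all _ fun ω => ?_)
    rw [Real.norm_eq_abs, abs_of_nonneg (sq_nonneg _), sq_le_one_iff_abs_le_one, abs_sub_comm]
    exact hbd ω
  · exact (hpqI.sub hpqp).const_mul _

/-! ### Deterministic oracle inequality -/

/-- Coordinatewise: the triangle inequality on the support of `θ₀`, and equality off it, where the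
penalty of `θ` is the error itself. -/
lemma l1Norm_sub_l1Norm_le {d : ℕ} (θ₀ θ : EuclideanSpace ℝ (Fin d)) :
    l1Norm θ₀ - l1Norm θ ≤
      2 * ∑ j with θ₀ j ≠ 0, |(θ - θ₀) j| - l1Norm (θ - θ₀) := by
  simp only [l1Norm, Finset.sum_filter, Finset.mul_sum]
  rw [← Finset.sum_sub_distrib, ← Finset.sum_sub_distrib]
  refine Finset.sum_le_sum fun j _ => ?_
  rw [PiLp.sub_apply]
  split_ifs with h
  · have := abs_sub_abs_le_abs_sub (θ₀ j) (θ j)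
    rw [abs_sub_comm] at this
    linarith
  · rw [not_not] at h
    simp [h]

lemma sq_sum_support_le {d : ℕ} (θ₀ v : EuclideanSpace ℝ (Fin d)) :
    (∑ j with θ₀ j ≠ 0, |v j|) ^ 2 ≤ numNonzero θ₀ * ‖v‖ ^ 2 := by
  refine sq_sum_le_card_mul_sum_sq.trans ?_
  have e : numNonzero θ₀ = (Finset.univ.filter fun j => θ₀ j ≠ 0).card := by
    rw [numNonzero, Set.ncard_eq_toFinset_card']
    congr 1
    ext j
    simp
  rw [e, EuclideanSpace.real_norm_sq_eq]
  gcongr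
  simp only [sq_abs]
  exact Finset.sum_le_sum_of_subset_of_nonneg (Finset.filter_subset _ _)
    fun _ _ _ => sq_nonneg _

/-- The deterministic part of the oracle inequality. -/
lemma l1Norm_sub_le_of_basic_inequality {d : ℕ} {θ₀ θ : EuclideanSpace ℝ (Fin d)} {c lam : ℝ}
    (hc : 0 < c) (hlam : 0 < lam)
    (h : c * min (‖θ - θ₀‖ ^ 2) 1 ≤
      lam * (l1Norm θ₀ - l1Norm θ) + lam / 2 * l1Norm (θ - θ₀))
    (hsmall : 3 / 2 * (lam * l1Norm θ₀) < c) :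
    l1Norm (θ - θ₀) ≤ 2 * lam * numNonzero θ₀ / c := by
  have htri : l1Norm (θ - θ₀) ≤ l1Norm θ + l1Norm θ₀ := by
    simp only [l1Norm, ← Finset.sum_add_distrib]
    exact Finset.sum_le_sum fun j _ => abs_sub _ _
  -- Otherwise the left side of `h` is `c`, while the right side is at most `3 / 2 * (lam * l1Norm
  -- θ₀)` by the triangle inequality, contradicting `hsmall`.
  have hmin : min (‖θ - θ₀‖ ^ 2) 1 = ‖θ - θ₀‖ ^ 2 := by
    refine min_eq_left (not_lt.1 fun hlt => ?_)
    rw [min_eq_right hlt.le] at h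
    have h1 := mul_le_mul_of_nonneg_left htri (half_pos hlam).le
    have h2 := mul_nonneg hlam.le (l1Norm_nonneg θ)
    linarith
  rw [hmin] at h
  have h1 := mul_le_mul_of_nonneg_left (l1Norm_sub_l1Norm_le θ₀ θ) hlam.le
  have h2 := sq_sum_support_le θ₀ (θ - θ₀)
  set A := ∑ j with θ₀ j ≠ 0, |(θ - θ₀) j| with hA
  have hA0 : 0 ≤ A := Finset.sum_nonneg fun _ _ => abs_nonneg _
  set N := l1Norm (θ - θ₀)
  set δ := ‖θ - θ₀‖
  set s : ℝ := (numNonzero θ₀ : ℝ)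
  have hs : 0 ≤ s := Nat.cast_nonneg _
  have h3 : c * δ ^ 2 + lam / 2 * N ≤ 2 * lam * A := by linarith
  -- Cauchy–Schwarz on the support, then Young's inequality; comparing squares avoids the square
  -- root of `s`. The term `c ^ 2 * δ ^ 2` then cancels against the curvature.
  have h4 : 2 * lam * A * c ≤ c ^ 2 * δ ^ 2 + lam ^ 2 * s := by
    refine abs_le_of_sq_le_sq' ?_ (by positivity) |>.2
    calc (2 * lam * A * c) ^ 2 = 4 * lam ^ 2 * c ^ 2 * A ^ 2 := by ring
      _ ≤ 4 * lam ^ 2 * c ^ 2 * (s * δ ^ 2) := by gcongr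
      _ ≤ _ := by nlinarith [sq_nonneg (c ^ 2 * δ ^ 2 - lam ^ 2 * s)]
  rw [le_div_iff₀ hc]
  have h5 := mul_le_mul_of_nonneg_right h3 hc.le
  have h6 : lam * (N * c) ≤ lam * (2 * lam * s) := by linarith
  exact le_of_mul_le_mul_left h6 hlam

/-! ### Oracle inequality in probability and the rate -/

lemma one_le_numNonzero {d : ℕ} {θ₀ : EuclideanSpace ℝ (Fin d)} (h : θ₀ ≠ 0) :
    1 ≤ numNonzero θ₀ := by
  rw [numNonzero, Nat.one_le_iff_ne_zero, Ne, Set.ncard_eq_zero (Set.toFinite _),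
    Set.eq_empty_iff_forall_notMem]
  intro h'
  refine h ?_
  ext j
  simpa using h' j

/-- A nonpositive bound would make `X` vanish almost surely, against the positive second moment. -/
lemma RegularCovariates.bound_pos {Ω : Type*} [MeasurableSpace Ω] {d : ℕ} {P : Measure Ω}
    [IsProbabilityMeasure P] {X : Ω → EuclideanSpace ℝ (Fin d)} {M ρ : ℝ}
    (hX : RegularCovariates P X M ρ) (hm : Measurable X) (hρ : 0 < ρ)
    {v : EuclideanSpace ℝ (Fin d)} (hv : v ≠ 0) : 0 < M := by
  by_contra! hM
  have h1 := hX.mul_norm_sq_le_integral hm v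
  have h2 : ∫ ω, inner ℝ (X ω) v ^ 2 ∂P = 0 := by
    refine integral_eq_zero_of_ae ?_
    filter_upwards [hX.ae_abs_inner_le v] with ω hω
    have := hω.trans (mul_nonpos_of_nonpos_of_nonneg hM (l1Norm_nonneg v))
    rw [abs_nonpos_iff.1 this]
    simp
  have := norm_pos_iff.2 hv
  have : 0 < ρ * ‖v‖ ^ 2 := by positivity
  linarith

/-- The oracle inequality at a fixed sample size: outside an event of probability at most `1 / n`,
the `ℓ¹`-error is at most `1 / n` or of order `lam` times the sparsity. -/
lemma measure_lt_l1Norm_sub_le {Ω : Type*} [MeasurableSpace Ω] {d n : ℕ} {P : Measure Ω}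
    [IsProbabilityMeasure P] {X : Ω → EuclideanSpace ℝ (Fin d)} {Y : Ω → ℝ}
    {x : Fin n → Ω → EuclideanSpace ℝ (Fin d)} {y : Fin n → Ω → ℝ} {σ : ℝ → ℝ}
    {θ₀ : EuclideanSpace ℝ (Fin d)} {M ρ Mσ lam c : ℝ}
    (hX : RegularCovariates P X M ρ) (hmodel : BinaryModel P X Y σ θ₀)
    (hsample : IsIIDSample P X Y x y) (hσc : Continuous σ)
    (hσ : ∀ t, σ t ∈ Set.Icc (0 : ℝ) 1) (hMσ : 0 < Mσ) (hM0 : 0 < M)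
    (hL : ∀ a b, |σ a - σ b| ≤ Mσ * |a - b|) (hn : 1 ≤ n) (hθ₀ : θ₀ ≠ 0)
    (hlam : lam = 96 * Mσ * M * Real.sqrt (Real.log (4 * (n : ℝ) * (d : ℝ)) / (n : ℝ)))
    (hlam2 : 2 ≤ lam / 2 * (2 ^ n / n)) (hc : 0 < c)
    (hlower : ∀ θ, c * min (‖θ - θ₀‖ ^ 2) 1 ≤
      ∫ ω, (σ (inner ℝ (X ω) θ) - σ (inner ℝ (X ω) θ₀)) ^ 2 ∂P)
    (hsmall : 3 / 2 * (lam * l1Norm θ₀) < c)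
    {θhat : Ω → EuclideanSpace ℝ (Fin d)}
    (hθhat : ∀ᵐ ω ∂P, penalizedRisk σ lam (fun i => x i ω) (fun i => y i ω) (θhat ω)
      ≤ penalizedRisk σ lam (fun i => x i ω) (fun i => y i ω) θ₀) {B : ℝ} (hB : 1 / n ≤ B)
    (hB' : 2 * lam * numNonzero θ₀ / c ≤ B) :
    P {ω | B < l1Norm (θhat ω - θ₀)} ≤ ENNReal.ofReal (1 / n) := by
  have hd : NeZero d := ⟨by rintro rfl; exact hθ₀ (Subsingleton.elim _ _)⟩
  have hn0 : (0 : ℝ) < n := by exact_mod_cast hn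
  have hlam0 : 0 < lam := by
    by_contra! hneg
    have : lam / 2 * (2 ^ n / n) ≤ 0 :=
      mul_nonpos_of_nonpos_of_nonneg (by linarith) (by positivity)
    linarith
  have hmX := hmodel.measurable_X
  have hmY := hmodel.measurable_Y
  have hZ : AEMeasurable (fun ω => (X ω, Y ω)) P := by fun_prop
  set μ := P.map fun ω => (X ω, Y ω) with hμ
  have : IsProbabilityMeasure μ := Measure.isProbabilityMeasure_map hZ
  have hM : ∀ᵐ z ∂μ, ∀ j, |z.1 j| ≤ M := by
    rw [ae_all_iff]
    intro j
    rw [hμ, ae_map_iff hZ (measurableSet_le (by fun_prop) (by fun_prop))]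
    filter_upwards [hX.bounded] with ω hω using hω j
  have hY : ∀ᵐ z ∂μ, z.2 ∈ Set.Icc (0 : ℝ) 1 := by
    rw [hμ, ae_map_iff hZ (measurable_snd measurableSet_Icc)]
    filter_upwards [hmodel.binary] with ω hω
    rcases hω with h | h <;> simp [h]
  have hZi : ∀ i, AEMeasurable (fun ω => (x i ω, y i ω)) P := fun i =>
    (hsample.identDistrib i).aemeasurable_fst
  have hjoint : P.map (fun ω i => (x i ω, y i ω)) = Measure.pi fun _ : Fin n => μ := by
    rw [hsample.indep.map_fun_eq_pi_map hZi]
    congr 1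
    ext1 i
    exact (hsample.identDistrib i).map_eq
  have hdev := measure_pi_exists_lt_excessRisk_sub_le (θ₀ := θ₀) μ hσc hσ hMσ hM0 hL hM hY hn
    hlam hlam2
  rw [← hjoint] at hdev
  -- The deviation event is uniform in `θ`, so the random `θhat` may be inserted, and the
  -- outer-measure inequality requires no measurability of `θhat`.
  refine le_trans ?_ ((Measure.le_map_apply (aemeasurable_pi_lambda _ hZi) _).trans hdev)
  refine measure_mono_ae ?_
  filter_upwards [hθhat] with ω hω hlt
  refine ⟨θhat ω, hB.trans hlt.le, ?_⟩
  by_contra! hle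
  have hbasic : 1 / (n : ℝ) * ∑ i, excessLoss σ θ₀ (θhat ω) (x i ω, y i ω) ≤
      lam * (l1Norm θ₀ - l1Norm (θhat ω)) := by
    simp only [excessLoss, Finset.sum_sub_distrib]
    simp only [penalizedRisk] at hω
    linarith
  have h1 := hlower (θhat ω)
  rw [← hmodel.integral_excessLoss_map hσc hσ, ← hμ] at h1
  have h2 := l1Norm_sub_le_of_basic_inequality (θ := θhat ω) hc hlam0 (by linarith) hsmall
  have h3 : B < l1Norm (θhat ω - θ₀) := hlt
  linarith

theorem mainTheorem5
    (σ : ℝ → ℝ) (MX ρX Mσ M₀ : ℝ) (hρX : 0 < ρX)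
    -- the link function
    (hσ_range : ∀ t, σ t ∈ Set.Icc (0 : ℝ) 1)
    (hσ_diff : Differentiable ℝ σ)
    (hσ_inf : ∀ s : ℝ, 0 < s → ∃ c : ℝ, 0 < c ∧ ∀ t : ℝ, |t| ≤ s → c ≤ deriv σ t)
    (hσ_sup : ∀ t, deriv σ t ≤ Mσ)
    -- for every sample size `n`: a dimension, a probability space, a true parameter, a generic pair
    -- and a sample of size `n`
    (d : ℕ → ℕ)
    {Ω : ℕ → Type*} [∀ n, MeasurableSpace (Ω n)]
    (P : ∀ n, Measure (Ω n)) [∀ n, IsProbabilityMeasure (P n)]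
    (θ₀ : ∀ n, EuclideanSpace ℝ (Fin (d n)))
    (X : ∀ n, Ω n → EuclideanSpace ℝ (Fin (d n))) (Y : ∀ n, Ω n → ℝ)
    (x : ∀ n, Fin n → Ω n → EuclideanSpace ℝ (Fin (d n))) (y : ∀ n, Fin n → Ω n → ℝ)
    (hX : ∀ n, 1 ≤ n → RegularCovariates (P n) (X n) MX ρX)
    (hmodel : ∀ n, 1 ≤ n → BinaryModel (P n) (X n) (Y n) σ (θ₀ n))
    (hsample : ∀ n, 1 ≤ n → IsIIDSample (P n) (X n) (Y n) (x n) (y n))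
    (hθ₀_ne : ∀ n, 1 ≤ n → θ₀ n ≠ 0)
    (hθ₀_bdd : ∀ n, 1 ≤ n → ‖θ₀ n‖ ≤ M₀)
    (hsparse : Tendsto
      (fun n : ℕ => Real.log ((n : ℝ) * (d n : ℝ)) * l1Norm (θ₀ n) ^ 2 / (n : ℝ)) atTop (𝓝 0))
    -- the penalty level
    (lam : ℕ → ℝ)
    (hlam : ∀ n, 1 ≤ n →
      lam n = 96 * Mσ * MX * Real.sqrt (Real.log (4 * (n : ℝ) * (d n : ℝ)) / (n : ℝ)))
    -- the estimator: any minimizer of the penalized criterion over the whole space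
    (θhat : ∀ n, Ω n → EuclideanSpace ℝ (Fin (d n)))
    (hθhat : ∀ n, 1 ≤ n → ∀ᵐ ω ∂(P n), ∀ θ : EuclideanSpace ℝ (Fin (d n)),
      penalizedRisk σ (lam n) (fun i => x n i ω) (fun i => y n i ω) (θhat n ω)
        ≤ penalizedRisk σ (lam n) (fun i => x n i ω) (fun i => y n i ω) θ) :
    IsBigOInProbability P (fun n ω => l1Norm (θhat n ω - θ₀ n))
      (fun n => (numNonzero (θ₀ n) : ℝ) *
        Real.sqrt (Real.log ((n : ℝ) * (d n : ℝ)) / (n : ℝ))) := by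
  have hmono := (strictMono_of_deriv_lower_bound hσ_inf).monotone
  have hMσ : 0 < Mσ := by
    obtain ⟨c, hc, h⟩ := hσ_inf 1 one_pos
    exact hc.trans_le ((h 0 (by simp)).trans (hσ_sup 0))
  have hL := abs_sub_le_of_deriv_le hσ_diff hmono hσ_sup
  have hMX : 0 < MX :=
    (hX 1 le_rfl).bound_pos (hmodel 1 le_rfl).measurable_X hρX (hθ₀_ne 1 le_rfl)
  obtain ⟨c, hc, hlower⟩ :=
    exists_mul_min_le_integral_sq_sub (M := MX) (M₀ := M₀) hρX hσ_diff hσ_range hσ_inf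
  set C := 192 * Mσ * MX with hC
  have hC0 : 0 < C := by positivity
  intro ε hε
  -- The summand `1` covers the minimal radius `1 / n` of the deviation bound, and `2 * C / c` the
  -- oracle bound `2 * lam * s₀ / c` with `lam ≤ C * √(log (n d) / n)`.
  refine ⟨1 + 2 * C / c, by positivity, ?_⟩
  have hev1 : ∀ᶠ n : ℕ in atTop, 1 / (n : ℝ) < ε :=
    tendsto_one_div_atTop_nhds_zero_nat.eventually_lt_const hε
  -- With `lam ≥ 96 * Mσ * MX / n`, this puts the margin at the outermost peeling radius above `2`.
  have hev2 : ∀ᶠ n : ℕ in atTop, (n : ℝ) ^ 2 / 2 ^ n < 24 * Mσ * MX :=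
    (tendsto_pow_const_div_const_pow_of_one_lt 2 one_lt_two).eventually_lt_const (by positivity)
  have hev3 := hsparse.eventually_lt_const (show 0 < (2 * c / (3 * C)) ^ 2 by positivity)
  -- Requiring `n ≥ 2` keeps `log (n d) ≥ log 2`, so that `log (4 n d) ≤ 4 * log (n d)`; at `n = d =
  -- 1` the rate would be zero.
  filter_upwards [hev1, hev2, hev3, eventually_ge_atTop 2] with n h1 h2 h3 hn
  have hn1 : 1 ≤ n := by omega
  have hd : NeZero (d n) := ⟨fun h => hθ₀_ne n hn1 (by
    have : IsEmpty (Fin (d n)) := by rw [h]; infer_instance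
    exact Subsingleton.elim _ _)⟩
  have hd1 : (1 : ℝ) ≤ d n := by exact_mod_cast NeZero.one_le
  have hn2 : (2 : ℝ) ≤ n := by exact_mod_cast hn
  have hn0 : (0 : ℝ) < n := by linarith
  have hnd : (2 : ℝ) ≤ n * d n := by nlinarith
  have hlog2 : Real.log 2 ≤ Real.log (n * d n) := Real.log_le_log two_pos hnd
  have hl2 := Real.log_two_gt_d9
  have hlog4 : Real.log (4 * n * d n) = 2 * Real.log 2 + Real.log (n * d n) := by
    rw [mul_assoc, Real.log_mul (by norm_num) (by positivity),
      show (4 : ℝ) = 2 ^ 2 by norm_num, Real.log_pow]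
    norm_num
  set ℓ := Real.log (n * d n) with hℓ
  have hlamle : lam n ≤ C * Real.sqrt (ℓ / n) := by
    have : Real.sqrt (Real.log (4 * n * d n) / n) ≤ 2 * Real.sqrt (ℓ / n) := by
      rw [show (2 : ℝ) = Real.sqrt 4 by
        rw [show (4 : ℝ) = 2 ^ 2 by norm_num, Real.sqrt_sq two_pos.le],
        ← Real.sqrt_mul (by norm_num), ← mul_div_assoc]
      apply Real.sqrt_le_sqrt
      gcongr
      linarith
    rw [hlam n hn1, hC]
    calc _ ≤ 96 * Mσ * MX * (2 * Real.sqrt (ℓ / n)) := by gcongr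
      _ = _ := by ring
  have hlamge : 96 * Mσ * MX * (1 / n) ≤ lam n := by
    rw [hlam n hn1]
    gcongr
    apply Real.le_sqrt_of_sq_le
    rw [div_pow, one_pow, pow_two, ← div_div]
    gcongr
    rw [div_le_iff₀ hn0]
    nlinarith
  have hlam0 : 0 < lam n := lt_of_lt_of_le (by positivity) hlamge
  have hsmall : 3 / 2 * (lam n * l1Norm (θ₀ n)) < c := by
    have hl0 := l1Norm_nonneg (θ₀ n)
    have h4 : (Real.sqrt (ℓ / n) * l1Norm (θ₀ n)) ^ 2 < (2 * c / (3 * C)) ^ 2 := by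
      rw [mul_pow, Real.sq_sqrt (div_nonneg (by linarith) hn0.le)]
      refine lt_of_eq_of_lt ?_ h3
      ring
    have h5 := (abs_lt_of_sq_lt_sq' h4 (by positivity)).2
    calc 3 / 2 * (lam n * l1Norm (θ₀ n))
        ≤ 3 / 2 * (C * Real.sqrt (ℓ / n) * l1Norm (θ₀ n)) := by gcongr
      _ = 3 / 2 * C * (Real.sqrt (ℓ / n) * l1Norm (θ₀ n)) := by ring
      _ < 3 / 2 * C * (2 * c / (3 * C)) := by gcongr
      _ = c := by field_simp
  have hlam2 : 2 ≤ lam n / 2 * (2 ^ n / n) := by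
    rw [div_lt_iff₀ (by positivity)] at h2
    calc (2 : ℝ) ≤ 96 * Mσ * MX * (1 / n) / 2 * (2 ^ n / n) := by
          have e : 96 * Mσ * MX * (1 / (n : ℝ)) / 2 * (2 ^ n / n) =
              2 * (24 * Mσ * MX * 2 ^ n) / n ^ 2 := by field_simp; norm_num
          rw [e, le_div_iff₀ (by positivity)]
          linarith
      _ ≤ _ := by gcongr
  have hs : (1 : ℝ) ≤ numNonzero (θ₀ n) := by exact_mod_cast one_le_numNonzero (hθ₀_ne n hn1)
  have hrate : 1 / (n : ℝ) ≤ numNonzero (θ₀ n) * Real.sqrt (ℓ / n) := by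
    have : 1 / (n : ℝ) ≤ Real.sqrt (ℓ / n) := by
      apply Real.le_sqrt_of_sq_le
      rw [div_pow, one_pow, pow_two, ← div_div]
      gcongr
      rw [div_le_iff₀ hn0]
      nlinarith
    exact this.trans (le_mul_of_one_le_left (Real.sqrt_nonneg _) hs)
  have ha0 : 0 ≤ numNonzero (θ₀ n) * Real.sqrt (ℓ / n) := by positivity
  have hmain := measure_lt_l1Norm_sub_le (hX n hn1) (hmodel n hn1) (hsample n hn1)
    hσ_diff.continuous hσ_range hMσ hMX hL hn1 (hθ₀_ne n hn1) (hlam n hn1) hlam2 hc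
    (fun θ => hlower (P n) (X n) (hmodel n hn1).measurable_X (hX n hn1) (θ₀ n) θ
      (hθ₀_bdd n hn1)) hsmall (θhat := θhat n)
    (by filter_upwards [hθhat n hn1] with ω hω using hω (θ₀ n))
    (B := (1 + 2 * C / c) * (numNonzero (θ₀ n) * Real.sqrt (ℓ / n)))
    (hrate.trans (le_mul_of_one_le_left ha0 (le_add_of_nonneg_right (by positivity))))
    (by
      calc 2 * lam n * numNonzero (θ₀ n) / c
          ≤ 2 * (C * Real.sqrt (ℓ / n)) * numNonzero (θ₀ n) / c := by gcongr
        _ = 2 * C / c * (numNonzero (θ₀ n) * Real.sqrt (ℓ / n)) := by ring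
        _ ≤ _ := by
          gcongr
          linarith)
  simp only [abs_of_nonneg (l1Norm_nonneg _)]
  exact hmain.trans (ENNReal.ofReal_le_ofReal h1.le)
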